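/- Let $n,m,r,p\ge 0$ be integers, let $A,Q,A_0^i\in\mathbb{R}^{n\times n}$, $B,L,B_0^i\in\mathbb{R}^{n\times m}$ ($1\le i\le r$), $R\in\mathbb{R}^{m\times m}$, and put $$\Pi_{11}(X)=\sum_{i=1}^r A_0^{i\,T}XA_0^i,\qquad \Pi_{12}(X)=\sum_{i=1}^r A_0^{i\,T}XB_0^i,\qquad \Pi_{22}(X)=\sum_{i=1}^r B_0^{i\,T}XB_0^i,$$ $L_c(X)=L+\Pi_{12}(X)$, $R_c(X)=R+\Pi_{22}(X)$, $Q_c(X)=Q+\Pi_{11}(X)$, $A_c(X)=A-BR_c(X)^{-1}L_c(X)^T$, $G_c(X)=BR_c(X)^{-1}B^T$, $H_c(X)=Q_c(X)-L_c(X)R_c(X)^{-1}L_c(X)^T$, and $$\mathscr R(X)=A^TX+XA+Q+\Pi_{11}(X)-[XB+L+\Pi_{12}(X)]\,[R+\Pi_{22}(X)]^{-1}\,[XB+L+\Pi_{12}(X)]^T .$$ A real square matrix is called stable if all its eigenvalues have negative real part. Assume: 1. $R\succ 0$ and $\begin{bmatrix}Q&L\\L^T&R\end{bmatrix}\succeq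 0$. 2. There is $F\in\mathbb{R}^{m\times n}$ such that the linear differential equation $\dot S=(A+BF)S+S(A+BF)^T+\sum_{i=1}^r(A_0^i+B_0^iF)S(A_0^i+B_0^iF)^T$ in $\mathbb{R}^{n\times n}$ is exponentially stable. 3. For $C\in\mathbb{R}^{p\times n}$ with $C^TC=Q-LR^{-1}L^T$, $\widetilde A=A-BR^{-1}L^T$ and $\widetilde A_0^i=A_0^i-B_0^iR^{-1}L^T$, there is $K\in\mathbb{R}^{n\times p}$ such that $\dot S=(\widetilde A+KC)S+S(\widetilde A+KC)^T+\sum_{i=1}^r\widetilde A_0^iS\widetilde A_0^{i\,T}$ is exponentially stable. 4. $\mathcal N(Q-LR^{-1}L^T)\subseteq\mathcal N(L^T)\cap\bigcap_{i=1}^r\mathcal N(A_0^i)$. 5. $(A,B)$ is stabilizable and $(Q-LR^{-1}L^T,A)$ is detectable, i.e. there are $F,K$ such that $A+BF$ and $A+K(Q-LR^{-1}L^T)$ are stable. A stabilizing solution of a Riccati equation $A^TX+XA-XGX+H=0$ is a solution $X\in\mathbb{R}^{n\times n}$ for which $A-GX$ is stable. Given $X_0\succeq 0$, the FPSDA iteration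 (with exact inner solves, and run without a stopping test) is: with $A_k=A_c(X_k)$, $G_k=G_c(X_k)$, $H_k=H_c(X_k)$, let $Z$ be the stabilizing solution of $$(A_k-G_kX_k)^TZ+Z(A_k-G_kX_k)-ZG_kZ+\mathscr R(X_k)=0$$ and set $X_{k+1}=X_k+Z$. The SDA with shift $\gamma<0$ for $A^TX+XA-XGX+H=0$ is: with $A_{\pm\gamma}=A\pm\gamma I$ and $S=-A_{+\gamma}^T-HA_{+\gamma}^{-1}G$, set $E_0=I+2\gamma S^{-T}$, $X_0=2\gamma S^{-1}HA_{+\gamma}^{-1}$, $Y_0=A_{+\gamma}^{-1}G-A_{+\gamma}^{-1}GS^{-1}(-HA_{+\gamma}^{-1}G-A_{-\gamma}^T)$, and for $i\ge0$ $$E_{i+1}=E_i(I-Y_iX_i)^{-1}E_i,\quad X_{i+1}=X_i+E_i^TX_i(I-Y_iX_i)^{-1}E_i,\quad Y_{i+1}=Y_i+E_i(I-Y_iX_i)^{-1}Y_iE_i^T .$$ Then, for every $X_0\succeq 0$, the FPSDA iteration generates exactly one infinite sequence $\{X_k\}_{k\ge0}$, and for this sequence: (a) $X_k\succeq 0$ for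 every $k$; (b) for every $k$, the Riccati equation $A_k^TX+XA_k-XG_kX+H_k=0$ has a unique stabilizing solution, and this solution is $X_{k+1}$; (c) for every $k$ and every $\gamma<0$ such that $A_k+\gamma I$ is invertible, the SDA with shift $\gamma$ applied to the equation in (b) runs without breakdown (the matrix $S$ and all matrices $I-Y_iX_i$ are invertible), and its iterates, written $X_i^{\mathrm{SDA}}$, converge quadratically to $X_{k+1}$: $X_i^{\mathrm{SDA}}\to X_{k+1}$, and there is a constant $c$ (which may depend on $k$, $\gamma$ and the data) with $\|X_{i+1}^{\mathrm{SDA}}-X_{k+1}\|_F\le c\,\|X_i^{\mathrm{SDA}}-X_{k+1}\|_F^2$ for all $i\ge 0$. -/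

import Mathlib

open scoped Matrix Topology
open Filter

/-! ### Stability notions -/

/-- A real square matrix is stable if all its complex eigenvalues lie in the open left half-plane. -/
def IsStableMatrix {n : ℕ} (M : Matrix (Fin n) (Fin n) ℝ) : Prop :=
  ∀ z ∈ spectrum ℂ (M.map (algebraMap ℝ ℂ)), z.re < 0

/-- `(A, B)` is stabilizable: some state feedback `A + B F` is stable. -/
def IsStabilizablePair {n m : ℕ} (A : Matrix (Fin n) (Fin n) ℝ) (B : Matrix (Fin n) (Fin m) ℝ) :
    Prop :=
  ∃ F : Matrix (Fin m) (Fin n) ℝ, IsStableMatrix (A + B * F)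

/-- `(C, A)` is detectable: some output injection `A + K C` is stable. -/
def IsDetectablePair {n p : ℕ} (C : Matrix (Fin p) (Fin n) ℝ) (A : Matrix (Fin n) (Fin n) ℝ) :
    Prop :=
  ∃ K : Matrix (Fin n) (Fin p) ℝ, IsStableMatrix (A + K * C)

/-- Exponential stability of the autonomous differential equation `S' = 𝓛 S`. -/
def IsExpStable {E : Type*} [NormedAddCommGroup E] [NormedSpace ℝ E] (𝓛 : E → E) : Prop :=
  ∃ β α : ℝ, 0 < β ∧ 0 < α ∧ ∀ S : ℝ → E, (∀ t, HasDerivAt S (𝓛 (S t)) t) →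
    ∀ t₀ t : ℝ, t₀ ≤ t → ‖S t‖ ≤ β * Real.exp (-α * (t - t₀)) * ‖S t₀‖

/-- Quadratic convergence of the sequence `x` to `l`. -/
def ConvergesQuadratically {E : Type*} [NormedAddCommGroup E] (x : ℕ → E) (l : E) : Prop :=
  Tendsto x atTop (𝓝 l) ∧ ∃ c : ℝ, ∀ i, ‖x (i + 1) - l‖ ≤ c * ‖x i - l‖ ^ 2

/-! ### The stochastic algebraic Riccati equation -/

/-- The coefficient matrices of a stochastic continuous-time algebraic Riccati equation. -/
structure SCARE (n m r : ℕ) where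
  A : Matrix (Fin n) (Fin n) ℝ
  B : Matrix (Fin n) (Fin m) ℝ
  Q : Matrix (Fin n) (Fin n) ℝ
  L : Matrix (Fin n) (Fin m) ℝ
  R : Matrix (Fin m) (Fin m) ℝ
  A₀ : Fin r → Matrix (Fin n) (Fin n) ℝ
  B₀ : Fin r → Matrix (Fin n) (Fin m) ℝ

namespace SCARE

variable {n m r : ℕ} (d : SCARE n m r)

def Pi11 (X : Matrix (Fin n) (Fin n) ℝ) : Matrix (Fin n) (Fin n) ℝ :=
  ∑ i, (d.A₀ i)ᵀ * X * d.A₀ i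

def Pi12 (X : Matrix (Fin n) (Fin n) ℝ) : Matrix (Fin n) (Fin m) ℝ :=
  ∑ i, (d.A₀ i)ᵀ * X * d.B₀ i

def Pi22 (X : Matrix (Fin n) (Fin n) ℝ) : Matrix (Fin m) (Fin m) ℝ :=
  ∑ i, (d.B₀ i)ᵀ * X * d.B₀ i

def Lc (X : Matrix (Fin n) (Fin n) ℝ) : Matrix (Fin n) (Fin m) ℝ := d.L + d.Pi12 X

def Rc (X : Matrix (Fin n) (Fin n) ℝ) : Matrix (Fin m) (Fin m) ℝ := d.R + d.Pi22 X

def Qc (X : Matrix (Fin n) (Fin n) ℝ) : Matrix (Fin n) (Fin n) ℝ := d.Q + d.Pi11 X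

noncomputable def Ac (X : Matrix (Fin n) (Fin n) ℝ) : Matrix (Fin n) (Fin n) ℝ :=
  d.A - d.B * (d.Rc X)⁻¹ * (d.Lc X)ᵀ

noncomputable def Gc (X : Matrix (Fin n) (Fin n) ℝ) : Matrix (Fin n) (Fin n) ℝ :=
  d.B * (d.Rc X)⁻¹ * d.Bᵀ

noncomputable def Hc (X : Matrix (Fin n) (Fin n) ℝ) : Matrix (Fin n) (Fin n) ℝ :=
  d.Qc X - d.Lc X * (d.Rc X)⁻¹ * (d.Lc X)ᵀ

/-- The left-hand side of the stochastic algebraic Riccati equation. -/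
noncomputable def residual (X : Matrix (Fin n) (Fin n) ℝ) : Matrix (Fin n) (Fin n) ℝ :=
  d.Aᵀ * X + X * d.A + d.Q + d.Pi11 X -
    (X * d.B + d.L + d.Pi12 X) * (d.R + d.Pi22 X)⁻¹ * (X * d.B + d.L + d.Pi12 X)ᵀ

/-- `Q - L R⁻¹ Lᵀ`. -/
noncomputable def schurQ : Matrix (Fin n) (Fin n) ℝ := d.Q - d.L * d.R⁻¹ * d.Lᵀ

section

attribute [local instance] Matrix.frobeniusNormedAddCommGroup Matrix.frobeniusNormedSpace

/-- The pair `({A₀ⁱ}, {B₀ⁱ})`, `0 ≤ i ≤ r` (with `A`, `B` for `i = 0`), is stabilizable. -/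
def IsStabilizable : Prop :=
  ∃ F : Matrix (Fin m) (Fin n) ℝ,
    IsExpStable fun S : Matrix (Fin n) (Fin n) ℝ =>
      (d.A + d.B * F) * S + S * (d.A + d.B * F)ᵀ +
        ∑ i, (d.A₀ i + d.B₀ i * F) * S * (d.A₀ i + d.B₀ i * F)ᵀ

/-- The pair `(C, {Ã₀ⁱ})`, `0 ≤ i ≤ r`, with `Ã₀ⁱ = A₀ⁱ - B₀ⁱ R⁻¹ Lᵀ` (and `A`, `B` for `i = 0`),
is detectable. -/
def IsDetectable {p : ℕ} (C : Matrix (Fin p) (Fin n) ℝ) : Prop :=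
  ∃ K : Matrix (Fin n) (Fin p) ℝ,
    IsExpStable fun S : Matrix (Fin n) (Fin n) ℝ =>
      (d.A - d.B * d.R⁻¹ * d.Lᵀ + K * C) * S + S * (d.A - d.B * d.R⁻¹ * d.Lᵀ + K * C)ᵀ +
        ∑ i, (d.A₀ i - d.B₀ i * d.R⁻¹ * d.Lᵀ) * S * (d.A₀ i - d.B₀ i * d.R⁻¹ * d.Lᵀ)ᵀ

end

end SCARE

/-! ### The algebraic Riccati equation `Aᵀ X + X A - X G X + H = 0` -/

/-- `X` is a stabilizing solution: it solves the equation and `A - G X` is stable. -/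
def IsStabilizingSolution {n : ℕ} (A G H X : Matrix (Fin n) (Fin n) ℝ) : Prop :=
  Aᵀ * X + X * A - X * G * X + H = 0 ∧ IsStableMatrix (A - G * X)

/-! ### The structure-preserving doubling algorithm -/

structure SDAState (n : ℕ) where
  E : Matrix (Fin n) (Fin n) ℝ
  X : Matrix (Fin n) (Fin n) ℝ
  Y : Matrix (Fin n) (Fin n) ℝ

namespace SDA

variable {n : ℕ}

/-- The matrix `S = -A₊ᵀ - H A₊⁻¹ G` with `A₊ = A + γ I`. -/
noncomputable def S (A G H : Matrix (Fin n) (Fin n) ℝ) (γ : ℝ) : Matrix (Fin n) (Fin n) ℝ :=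
  -(A + γ • 1)ᵀ - H * (A + γ • 1)⁻¹ * G

noncomputable def init (A G H : Matrix (Fin n) (Fin n) ℝ) (γ : ℝ) : SDAState n where
  E := 1 + (2 * γ) • ((S A G H γ)⁻¹)ᵀ
  X := (2 * γ) • ((S A G H γ)⁻¹ * H * (A + γ • 1)⁻¹)
  Y := (A + γ • 1)⁻¹ * G -
    (A + γ • 1)⁻¹ * G * (S A G H γ)⁻¹ * (-(H * (A + γ • 1)⁻¹ * G) - (A - γ • 1)ᵀ)

noncomputable def step (s : SDAState n) : SDAState n where
  E := s.E * (1 - s.Y * s.X)⁻¹ * s.E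
  X := s.X + s.Eᵀ * s.X * (1 - s.Y * s.X)⁻¹ * s.E
  Y := s.Y + s.E * (1 - s.Y * s.X)⁻¹ * s.Y * s.Eᵀ

/-- The `i`-th iterate `(E_i, X_i, Y_i)` of the doubling algorithm with shift `γ`. -/
noncomputable def iter (A G H : Matrix (Fin n) (Fin n) ℝ) (γ : ℝ) : ℕ → SDAState n
  | 0 => init A G H γ
  | i + 1 => step (iter A G H γ i)

/-- Every matrix that the algorithm inverts is invertible. -/
def NoBreakdown (A G H : Matrix (Fin n) (Fin n) ℝ) (γ : ℝ) : Prop :=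
  IsUnit (A + γ • (1 : Matrix (Fin n) (Fin n) ℝ)) ∧ IsUnit (S A G H γ) ∧
    ∀ i, IsUnit (1 - (iter A G H γ i).Y * (iter A G H γ i).X)

section

attribute [local instance] Matrix.frobeniusNormedAddCommGroup

/-- The approximations `X_i` of the doubling algorithm converge quadratically to `Xs`. -/
def ConvergesQuadraticallyTo (A G H : Matrix (Fin n) (Fin n) ℝ) (γ : ℝ)
    (Xs : Matrix (Fin n) (Fin n) ℝ) : Prop :=
  ConvergesQuadratically (fun i => (iter A G H γ i).X) Xs

end

end SDA

/-- `X` is the sequence of outer iterates of the fixed-point iteration started from `X₀`, with exact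
inner solves: `X_{k+1} = X_k + Z`, where `Z` is a stabilizing solution of
`(A_k - G_k X_k)ᵀ Z + Z (A_k - G_k X_k) - Z G_k Z + 𝓡(X_k) = 0`. -/
def SCARE.IsFPSDASequence {n m r : ℕ} (d : SCARE n m r) (X₀ : Matrix (Fin n) (Fin n) ℝ)
    (X : ℕ → Matrix (Fin n) (Fin n) ℝ) : Prop :=
  X 0 = X₀ ∧ ∀ k, ∃ Z : Matrix (Fin n) (Fin n) ℝ,
    IsStabilizingSolution (d.Ac (X k) - d.Gc (X k) * X k) (d.Gc (X k)) (d.residual (X k)) Z ∧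
      X (k + 1) = X k + Z

/-! Freezing the stochastic terms at X ⪰ 0 leaves a classical Riccati equation with G = G_c(X) ⪰ 0
and H = H_c(X) ⪰ 0; completing squares gives H = Q - L R⁻¹ Lᵀ plus a positive semidefinite matrix
(`Hc_eq`). As R_c(X)⁻¹ is definite, G and Bᵀ have the same kernel, so stabilizability of (A, B)
passes to (A_c, G). The kernel condition makes L_cᵀ vanish on ker H, so detectability passes to (H,
A_c). Newton–Kleinman iteration then produces a positive semidefinite stabilizing solution, unique
because the difference of two solutions satisfies a homogeneous Sylvester equation. By translation
invariance the equation for Z is the frozen equation for X_k + Z, so X_{k+1} is this solution and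
the outer iteration continues.

For the doubling algorithm, let X be the stabilizing solution, T the Cayley transform of A - G X
(spectral radius below 1) and R_i = T^(2^i). Two facts persist along the iteration: X_i and -Y_i are
positive semidefinite, so 1 - Y_i X_i is invertible; and E_i = (1 - Y_i X) R_i, X - X_i = E_iᵀ X
R_i. Hence X - X_i = R_iᵀ X R_i + (X R_i)ᵀ (-Y_i) (X R_i). The dual equation bounds -Y_i, so X_i →
X.

For the quadratic rate X may be singular, so the error controls only X R_i: ‖X R_i‖² = O(‖X - X_i‖).
Since ker X ⊆ ker (X R_i), a generalized inverse N of X gives X R_{i+1} = X R_i N X R_i. The error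
at i+1 is quadratic in X R_{i+1}, hence of fourth order in X R_i and of second order in the error at
i. -/

namespace Matrix

variable {n m : ℕ}

/-! ### Real positive semidefinite matrices -/

theorem posSemidef_real_iff {M : Matrix (Fin n) (Fin n) ℝ} :
    M.PosSemidef ↔ Mᵀ = M ∧ ∀ v, 0 ≤ v ⬝ᵥ M *ᵥ v := by
  rw [posSemidef_iff_dotProduct_mulVec, IsHermitian, conjTranspose_eq_transpose_of_trivial]
  simp

theorem PosSemidef.transpose_eq {M : Matrix (Fin n) (Fin n) ℝ} (h : M.PosSemidef) : Mᵀ = M :=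
  (posSemidef_real_iff.1 h).1

theorem PosSemidef.transpose_mul_mul {M : Matrix (Fin n) (Fin n) ℝ} (h : M.PosSemidef)
    (B : Matrix (Fin n) (Fin m) ℝ) : (Bᵀ * M * B).PosSemidef := by
  simpa using h.conjTranspose_mul_mul_same B

theorem PosSemidef.mul_mul_transpose {M : Matrix (Fin n) (Fin n) ℝ} (h : M.PosSemidef)
    (B : Matrix (Fin m) (Fin n) ℝ) : (B * M * Bᵀ).PosSemidef := by
  simpa using h.mul_mul_conjTranspose_same B

theorem PosSemidef.exists_transpose_mul_self {M : Matrix (Fin n) (Fin n) ℝ} (h : M.PosSemidef) :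
    ∃ C : Matrix (Fin n) (Fin n) ℝ, M = Cᵀ * C := by
  open scoped MatrixOrder in
  obtain ⟨B, rfl⟩ := CStarAlgebra.nonneg_iff_eq_star_mul_self.mp h.nonneg
  exact ⟨B, by rw [star_eq_conjTranspose, conjTranspose_eq_transpose_of_trivial]⟩

theorem PosSemidef.mulVec_eq_zero {M : Matrix (Fin n) (Fin n) ℝ} (h : M.PosSemidef)
    {v : Fin n → ℝ} (hv : v ⬝ᵥ M *ᵥ v = 0) : M *ᵥ v = 0 :=
  (h.dotProduct_mulVec_zero_iff v).1 (by simpa using hv)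

theorem PosSemidef.of_tendsto {M : ℕ → Matrix (Fin n) (Fin n) ℝ} {M' : Matrix (Fin n) (Fin n) ℝ}
    (h : Tendsto M atTop (𝓝 M')) (hM : ∀ k, (M k).PosSemidef) : M'.PosSemidef := by
  refine posSemidef_real_iff.2 ⟨?_, fun v => ?_⟩
  · refine tendsto_nhds_unique (f := fun k => (M k)ᵀ) (l := atTop) ?_ ?_
    · exact (continuous_id.matrix_transpose.tendsto M').comp h
    · simpa only [(hM _).transpose_eq] using h
  · have hc : Continuous fun X : Matrix (Fin n) (Fin n) ℝ => v ⬝ᵥ X *ᵥ v := by fun_prop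
    exact ge_of_tendsto' ((hc.tendsto M').comp h) fun k => (posSemidef_real_iff.1 (hM k)).2 v

/-- A decreasing sequence of positive semidefinite matrices converges. -/
theorem exists_tendsto_of_posSemidef_antitone {M : ℕ → Matrix (Fin n) (Fin n) ℝ}
    (hM : ∀ k, (M k).PosSemidef) (hanti : ∀ k, (M k - M (k + 1)).PosSemidef) :
    ∃ M', Tendsto M atTop (𝓝 M') := by
  have hq : ∀ v : Fin n → ℝ, ∃ l, Tendsto (fun k => v ⬝ᵥ M k *ᵥ v) atTop (𝓝 l) := fun v =>
    ⟨_, tendsto_atTop_ciInf (antitone_nat_of_succ_le fun k => by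
        have := (posSemidef_real_iff.1 (hanti k)).2 v
        rw [sub_mulVec, dotProduct_sub] at this
        linarith)
      ⟨0, by rintro _ ⟨k, rfl⟩; exact (posSemidef_real_iff.1 (hM k)).2 v⟩⟩
  choose l hl using hq
  -- Polarization: the entries are combinations of values of the quadratic form, each of which is
  -- monotone and bounded.
  have hentry : ∀ i j k, M k i j =
      ((Pi.single i 1 + Pi.single j 1) ⬝ᵥ M k *ᵥ (Pi.single i 1 + Pi.single j 1) -
        Pi.single i 1 ⬝ᵥ M k *ᵥ Pi.single i 1 - Pi.single j 1 ⬝ᵥ M k *ᵥ Pi.single j 1) / 2 := by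
    intro i j k
    have hs : M k j i = M k i j := congrFun₂ (hM k).transpose_eq i j
    simp only [mulVec_add, dotProduct_add, add_dotProduct, mulVec_single_one, single_one_dotProduct,
      col_apply, hs]
    ring
  refine ⟨fun i j => (l (Pi.single i 1 + Pi.single j 1) - l (Pi.single i 1) -
    l (Pi.single j 1)) / 2, ?_⟩
  refine tendsto_pi_nhds.2 fun i => tendsto_pi_nhds.2 fun j => ?_
  simp only [hentry]
  exact (((hl _).sub (hl _)).sub (hl _)).div_const 2

/-- If v + G X v = 0, pairing with X v makes two nonnegative terms sum to zero; hence X v = 0, and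
then v = 0. -/
theorem isUnit_one_add_mul {G X : Matrix (Fin n) (Fin n) ℝ} (hG : G.PosSemidef)
    (hX : X.PosSemidef) : IsUnit (1 + G * X) := by
  rw [isUnit_iff_isUnit_det, isUnit_iff_ne_zero]
  intro hdet
  obtain ⟨v, hv, h⟩ := exists_mulVec_eq_zero_iff.2 hdet
  rw [add_mulVec, one_mulVec, ← mulVec_mulVec] at h
  have hq : v ⬝ᵥ X *ᵥ v + (X *ᵥ v) ⬝ᵥ G *ᵥ (X *ᵥ v) = 0 := by
    rw [dotProduct_comm v, ← dotProduct_add, h, dotProduct_zero]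
  have h1 := (posSemidef_real_iff.1 hX).2 v
  have h2 := (posSemidef_real_iff.1 hG).2 (X *ᵥ v)
  have h3 := hX.mulVec_eq_zero (v := v) (by linarith)
  rw [h3, mulVec_zero, add_zero] at h
  exact hv h

theorem isUnit_one_add_mul_det {G X : Matrix (Fin n) (Fin n) ℝ} (hG : G.PosSemidef)
    (hX : X.PosSemidef) : IsUnit (1 + G * X).det :=
  (isUnit_iff_isUnit_det _).1 (isUnit_one_add_mul hG hX)

theorem mul_inv_one_add_mul_comm {G X : Matrix (Fin n) (Fin n) ℝ} (hG : G.PosSemidef)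
    (hX : X.PosSemidef) : X * (1 + G * X)⁻¹ = (1 + X * G)⁻¹ * X := by
  have h1 := isUnit_one_add_mul_det hG hX
  have h2 := isUnit_one_add_mul_det hX hG
  calc X * (1 + G * X)⁻¹ = (1 + X * G)⁻¹ * ((1 + X * G) * X) * (1 + G * X)⁻¹ := by
        rw [nonsing_inv_mul_cancel_left _ _ h2]
    _ = (1 + X * G)⁻¹ * (X * (1 + G * X)) * (1 + G * X)⁻¹ := by
        congr 2; noncomm_ring
    _ = (1 + X * G)⁻¹ * X := by
        rw [← Matrix.mul_assoc, mul_nonsing_inv_cancel_right _ _ h1]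

theorem posSemidef_mul_inv_one_add_mul {G X : Matrix (Fin n) (Fin n) ℝ} (hG : G.PosSemidef)
    (hX : X.PosSemidef) : (X * (1 + G * X)⁻¹).PosSemidef := by
  have h2 := isUnit_one_add_mul_det hX hG
  have h : X * (1 + G * X)⁻¹ = ((1 + G * X)⁻¹)ᵀ * (X + Xᵀ * G * X) * (1 + G * X)⁻¹ := by
    rw [transpose_nonsing_inv, transpose_add, transpose_mul, transpose_one, hG.transpose_eq,
      hX.transpose_eq]
    congr 1
    rw [show X + X * G * X = (1 + X * G) * X by noncomm_ring, nonsing_inv_mul_cancel_left _ _ h2]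
  rw [h]
  exact (hX.add (hG.transpose_mul_mul X)).transpose_mul_mul _

/-! ### Factorization through kernels -/

/-- A right inverse of M onto its range, extended to the whole space, serves as generalized inverse.
-/
theorem exists_mul_mul_self (M : Matrix (Fin n) (Fin m) ℝ) :
    ∃ N : Matrix (Fin m) (Fin n) ℝ, M * N * M = M := by
  obtain ⟨g, hg⟩ := (toLin' M).rangeRestrict.exists_rightInverse_of_surjective
    (LinearMap.range_rangeRestrict _)
  obtain ⟨g', hg'⟩ := g.exists_extend
  refine ⟨LinearMap.toMatrix' g', toLin'.injective <| LinearMap.ext fun v => ?_⟩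
  rw [toLin'_mul, toLin'_mul, toLin'_toMatrix']
  have h1 : g' (toLin' M v) = g ((toLin' M).rangeRestrict v) := by rw [← hg']; rfl
  have h2 := congrArg Subtype.val (LinearMap.congr_fun hg ((toLin' M).rangeRestrict v))
  simp only [LinearMap.comp_apply, h1]
  exact h2

/-- The columns of 1 - N M lie in ker M, so T annihilates them. -/
theorem eq_mul_of_ker_le {p : ℕ} {M : Matrix (Fin n) (Fin m) ℝ} {T : Matrix (Fin p) (Fin m) ℝ}
    {N : Matrix (Fin m) (Fin n) ℝ} (hN : M * N * M = M) (h : ∀ v, M *ᵥ v = 0 → T *ᵥ v = 0) :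
    T = T * N * M := by
  refine ext_of_mulVec_single fun i => ?_
  have := h ((1 - N * M) *ᵥ Pi.single i 1) (by
    rw [mulVec_mulVec, Matrix.mul_sub, ← Matrix.mul_assoc, hN, sub_eq_zero.2 (Matrix.mul_one M), zero_mulVec])
  rwa [mulVec_mulVec, Matrix.mul_sub, ← Matrix.mul_assoc, sub_mulVec, sub_eq_zero,
    Matrix.mul_one] at this

theorem exists_eq_mul_of_ker_le {p : ℕ} {M : Matrix (Fin n) (Fin m) ℝ}
    {T : Matrix (Fin p) (Fin m) ℝ} (h : ∀ v, M *ᵥ v = 0 → T *ᵥ v = 0) :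
    ∃ K : Matrix (Fin p) (Fin n) ℝ, T = K * M := by
  obtain ⟨N, hN⟩ := exists_mul_mul_self M
  exact ⟨T * N, eq_mul_of_ker_le hN h⟩

end Matrix

/-! ### Stable matrices -/

namespace Matrix

variable {n m : ℕ}

/-- The complexification of a real matrix. -/
noncomputable abbrev toComplex (M : Matrix (Fin n) (Fin m) ℝ) : Matrix (Fin n) (Fin m) ℂ :=
  M.map (algebraMap ℝ ℂ)

theorem toComplex_mul {p : ℕ} (M : Matrix (Fin n) (Fin m) ℝ) (N : Matrix (Fin m) (Fin p) ℝ) :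
    (M * N).toComplex = M.toComplex * N.toComplex := Matrix.map_mul

theorem toComplex_add (M N : Matrix (Fin n) (Fin m) ℝ) :
    (M + N).toComplex = M.toComplex + N.toComplex :=
  Matrix.map_add _ (map_add _) _ _

theorem toComplex_sub (M N : Matrix (Fin n) (Fin m) ℝ) :
    (M - N).toComplex = M.toComplex - N.toComplex :=
  Matrix.map_sub _ (map_sub _) _ _

theorem toComplex_one : (1 : Matrix (Fin n) (Fin n) ℝ).toComplex = 1 :=
  Matrix.map_one _ (map_zero _) (map_one _)

theorem toComplex_zero : (0 : Matrix (Fin n) (Fin m) ℝ).toComplex = 0 :=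
  Matrix.map_zero _ (map_zero _)

theorem toComplex_smul (c : ℝ) (M : Matrix (Fin n) (Fin m) ℝ) :
    (c • M).toComplex = (c : ℂ) • M.toComplex := by
  ext; simp

theorem toComplex_pow (M : Matrix (Fin n) (Fin n) ℝ) (k : ℕ) :
    (M ^ k).toComplex = M.toComplex ^ k := by
  induction k with
  | zero => simp only [pow_zero, toComplex_one]
  | succ k ih => rw [pow_succ, pow_succ, toComplex_mul, ih]

theorem toComplex_transpose (M : Matrix (Fin n) (Fin m) ℝ) :
    (Mᵀ).toComplex = M.toComplexᴴ := by
  ext; simp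

open scoped ComplexOrder in
theorem PosSemidef.toComplex {M : Matrix (Fin n) (Fin n) ℝ} (h : M.PosSemidef) :
    M.toComplex.PosSemidef := by
  obtain ⟨C, rfl⟩ := h.exists_transpose_mul_self
  rw [toComplex_mul, toComplex_transpose]
  exact posSemidef_conjTranspose_mul_self _

theorem mem_spectrum_iff_exists_mulVec {M : Matrix (Fin n) (Fin n) ℂ} {z : ℂ} :
    z ∈ spectrum ℂ M ↔ ∃ v ≠ 0, M *ᵥ v = z • v := by
  rw [spectrum.mem_iff, isUnit_iff_isUnit_det, isUnit_iff_ne_zero, not_not,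
    ← exists_mulVec_eq_zero_iff]
  refine exists_congr fun v => and_congr_right fun _ => ?_
  rw [sub_mulVec, sub_eq_zero, Algebra.algebraMap_eq_smul_one, smul_mulVec, one_mulVec, eq_comm]

end Matrix

open Matrix

variable {n m : ℕ}

theorem isStableMatrix_iff {M : Matrix (Fin n) (Fin n) ℝ} :
    IsStableMatrix M ↔ ∀ (z : ℂ) (v : Fin n → ℂ), v ≠ 0 → M.toComplex *ᵥ v = z • v → z.re < 0 := by
  simp only [IsStableMatrix, mem_spectrum_iff_exists_mulVec]
  exact ⟨fun h z v hv hz => h z ⟨v, hv, hz⟩, fun h z ⟨v, hv, hz⟩ => h z v hv hz⟩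

theorem IsStableMatrix.transpose {M : Matrix (Fin n) (Fin n) ℝ} (h : IsStableMatrix M) :
    IsStableMatrix Mᵀ := by
  intro z hz
  refine h z ?_
  rw [spectrum.mem_iff] at hz ⊢
  refine fun hu => hz ?_
  rw [← isUnit_transpose] at hu
  convert hu using 1
  ext i j
  simp [algebraMap_matrix_apply, eq_comm]

/-- The Cayley transform `(M + γ)⁻¹ (M - γ)`. -/
noncomputable def cayley (γ : ℝ) (M : Matrix (Fin n) (Fin n) ℝ) : Matrix (Fin n) (Fin n) ℝ :=
  1 - (2 * γ) • (M + γ • 1)⁻¹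

theorem IsStableMatrix.isUnit_add_smul {M : Matrix (Fin n) (Fin n) ℝ} (h : IsStableMatrix M)
    {γ : ℝ} (hγ : γ < 0) : IsUnit (M + γ • (1 : Matrix (Fin n) (Fin n) ℝ)) := by
  rw [isUnit_iff_isUnit_det, isUnit_iff_ne_zero]
  intro hdet
  obtain ⟨v, hv, h0⟩ := exists_mulVec_eq_zero_iff.2 hdet
  rw [add_mulVec, smul_mulVec, one_mulVec] at h0
  have := isStableMatrix_iff.1 h (-γ : ℝ) (fun i => (v i : ℂ))
    (fun hz => hv (funext fun i => by simpa using congrFun hz i)) (by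
      ext i
      have := congrFun h0 i
      simp only [mulVec, dotProduct, Pi.add_apply, Pi.smul_apply, smul_eq_mul, Pi.zero_apply,
        map_apply, Complex.coe_algebraMap] at this ⊢
      rw [← Complex.ofReal_mul, show (-γ) * v i = ∑ j, M i j * v j by linarith]
      push_cast
      rfl)
  rw [Complex.ofReal_re] at this
  linarith

theorem IsStableMatrix.norm_lt_one_of_mem_spectrum_cayley {M : Matrix (Fin n) (Fin n) ℝ}
    (h : IsStableMatrix M) {γ : ℝ} (hγ : γ < 0) {z : ℂ}
    (hz : z ∈ spectrum ℂ (cayley γ M).toComplex) : ‖z‖ < 1 := by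
  obtain ⟨v, hv, hz⟩ := mem_spectrum_iff_exists_mulVec.1 hz
  have hu := (isUnit_iff_isUnit_det _).1 (h.isUnit_add_smul hγ)
  have hc : (M + γ • 1) * cayley γ M = M - γ • 1 := by
    rw [cayley, Matrix.mul_sub, Matrix.mul_smul, mul_nonsing_inv _ hu, Matrix.mul_one, two_mul,
      add_smul]
    abel
  have hv1 : (1 - z) • (M.toComplex *ᵥ v) = (γ * (1 + z)) • v := by
    have h1 := congrArg (fun N => toComplex N *ᵥ v) hc
    simp only [toComplex_mul, toComplex_add, toComplex_sub, toComplex_smul, toComplex_one] at h1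
    rw [← mulVec_mulVec, hz, mulVec_smul, add_mulVec, sub_mulVec, smul_mulVec, one_mulVec] at h1
    ext i
    have := congrFun h1 i
    simp only [Pi.smul_apply, Pi.add_apply, Pi.sub_apply, smul_eq_mul] at this ⊢
    linear_combination -this
  -- The Möbius map is inverted next: z comes from the eigenvalue γ(1+z)/(1-z) of M, whose real part
  -- is γ(1-|z|²)/|1-z|². The value z = 1 would give 2γ v = 0.
  have hz1 : 1 - z ≠ 0 := by
    intro h0
    rw [h0, zero_smul, eq_comm, smul_eq_zero, or_iff_left hv] at hv1
    have : (1 : ℂ) + z = 2 := by linear_combination -h0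
    rw [this] at hv1
    simp [hγ.ne] at hv1
  have hre := isStableMatrix_iff.1 h (γ * (1 + z) / (1 - z)) v hv (by
    rw [div_eq_inv_mul, mul_smul, ← hv1, smul_smul, inv_mul_cancel₀ hz1, one_smul])
  have hpos : 0 < Complex.normSq (1 - z) := Complex.normSq_pos.2 hz1
  have hre' : (γ * (1 + z) / (1 - z) : ℂ).re = γ * (1 - ‖z‖ ^ 2) / Complex.normSq (1 - z) := by
    rw [← Complex.normSq_eq_norm_sq, Complex.normSq_apply z, Complex.div_re]
    simp
    ring
  rw [hre', div_lt_iff₀ hpos, zero_mul] at hre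
  have : 0 < 1 - ‖z‖ ^ 2 := pos_of_mul_neg_right hre hγ.le
  nlinarith [norm_nonneg z]

/-! ### Powers of the Cayley transform tend to zero (Gelfand's formula) -/

section PowTendsto

attribute [local instance] Matrix.frobeniusNormedRing Matrix.frobeniusNormedAlgebra

theorem Matrix.tendsto_norm_pow_zero_of_spectrum {M : Matrix (Fin n) (Fin n) ℂ}
    (h : ∀ z ∈ spectrum ℂ M, ‖z‖ < 1) : Tendsto (fun k => ‖M ^ k‖) atTop (𝓝 0) := by
  have : CompleteSpace (Matrix (Fin n) (Fin n) ℂ) := FiniteDimensional.complete ℂ _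
  cases subsingleton_or_nontrivial (Matrix (Fin n) (Fin n) ℂ) with
  | inl _ => simp [Subsingleton.elim _ (0 : Matrix (Fin n) (Fin n) ℂ)]
  | inr _ =>
    have hr : spectralRadius ℂ M < (1 : NNReal) :=
      spectrum.spectralRadius_lt_of_forall_lt M fun z hz => h z hz
    obtain ⟨r, hr1, hr2⟩ := ENNReal.lt_iff_exists_nnreal_btwn.1 hr
    have hev := (spectrum.pow_nnnorm_pow_one_div_tendsto_nhds_spectralRadius M).eventually_lt_const
      hr1
    have hr2' : (r : ℝ) < 1 := by exact_mod_cast hr2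
    refine squeeze_zero' (Eventually.of_forall fun k => norm_nonneg _) ?_
      (tendsto_pow_atTop_nhds_zero_of_lt_one r.2 hr2')
    filter_upwards [hev, eventually_gt_atTop 0] with k hk hk0
    have hk' := ENNReal.rpow_le_rpow hk.le (Nat.cast_nonneg (α := ℝ) k)
    rw [← ENNReal.rpow_mul, one_div_mul_cancel (by positivity), ENNReal.rpow_one,
      ENNReal.rpow_natCast] at hk'
    exact_mod_cast hk'

theorem IsStableMatrix.tendsto_norm_cayley_pow {M : Matrix (Fin n) (Fin n) ℝ}
    (h : IsStableMatrix M) {γ : ℝ} (hγ : γ < 0) :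
    Tendsto (fun k => ‖cayley γ M ^ k‖) atTop (𝓝 0) := by
  have := tendsto_norm_pow_zero_of_spectrum fun z hz => h.norm_lt_one_of_mem_spectrum_cayley hγ hz
  refine this.congr fun k => ?_
  rw [← toComplex_pow]
  exact frobenius_norm_map_eq _ _ fun a => by simp

theorem IsStableMatrix.tendsto_cayley_pow {M : Matrix (Fin n) (Fin n) ℝ}
    (h : IsStableMatrix M) {γ : ℝ} (hγ : γ < 0) :
    Tendsto (fun k => cayley γ M ^ k) atTop (𝓝 0) :=
  tendsto_zero_iff_norm_tendsto_zero.2 (h.tendsto_norm_cayley_pow hγ)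

end PowTendsto

theorem IsStableMatrix.tendsto_transpose_mul_mul {M N : Matrix (Fin n) (Fin n) ℝ}
    (hM : IsStableMatrix M) (hN : IsStableMatrix N) {γ : ℝ} (hγ : γ < 0)
    (D : Matrix (Fin n) (Fin n) ℝ) :
    Tendsto (fun k => (cayley γ M ^ k)ᵀ * D * cayley γ N ^ k) atTop (𝓝 0) := by
  have h1 := hM.tendsto_cayley_pow hγ
  have h2 := hN.tendsto_cayley_pow hγ
  have h3 := ((continuous_id.matrix_transpose.tendsto _).comp h1)
  have hc : Continuous fun P : Matrix (Fin n) (Fin n) ℝ × Matrix (Fin n) (Fin n) ℝ =>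
    P.1 * D * P.2 := by fun_prop
  have h4 := (hc.tendsto _).comp (h3.prodMk_nhds h2)
  rwa [Matrix.mul_zero] at h4

/-! ### Sylvester and Lyapunov equations -/

/-- The Cayley transform turns a Sylvester equation into a Stein equation. -/
theorem cayley_stein {M N D : Matrix (Fin n) (Fin n) ℝ} {γ : ℝ}
    (hM : IsUnit (M + γ • (1 : Matrix (Fin n) (Fin n) ℝ)))
    (hN : IsUnit (N + γ • (1 : Matrix (Fin n) (Fin n) ℝ))) :
    D - (cayley γ M)ᵀ * D * cayley γ N =
      (2 * γ) • (((M + γ • 1)⁻¹)ᵀ * (Mᵀ * D + D * N) * (N + γ • 1)⁻¹) := by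
  rw [isUnit_iff_isUnit_det] at hM hN
  have h1 : ((M + γ • 1)⁻¹)ᵀ * (Mᵀ + γ • 1) = 1 := by
    rw [show Mᵀ + γ • 1 = (M + γ • 1)ᵀ by simp, ← transpose_mul, mul_nonsing_inv _ hM,
      transpose_one]
  have h2 : (N + γ • 1) * (N + γ • 1)⁻¹ = 1 := mul_nonsing_inv _ hN
  have h3 : Mᵀ * D + D * N = (Mᵀ + γ • 1) * D + D * (N + γ • 1) - (2 * γ) • D := by
    simp only [Matrix.add_mul, Matrix.mul_add, Matrix.smul_mul, Matrix.mul_smul, Matrix.one_mul,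
      Matrix.mul_one, two_mul, add_smul]
    abel
  have h4 : ((M + γ • 1)⁻¹)ᵀ * (Mᵀ * D + D * N) * (N + γ • 1)⁻¹ =
      D * (N + γ • 1)⁻¹ + ((M + γ • 1)⁻¹)ᵀ * D -
        (2 * γ) • (((M + γ • 1)⁻¹)ᵀ * D * (N + γ • 1)⁻¹) := by
    rw [h3, Matrix.mul_sub, Matrix.mul_add, ← Matrix.mul_assoc, h1, Matrix.one_mul, Matrix.sub_mul,
      Matrix.add_mul, ← Matrix.mul_assoc, Matrix.mul_assoc _ (N + γ • 1), h2, Matrix.mul_one,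
      Matrix.mul_smul, Matrix.smul_mul]
  rw [h4, cayley, cayley, transpose_sub, transpose_smul, transpose_one]
  simp only [Matrix.sub_mul, Matrix.mul_sub, Matrix.one_mul, Matrix.mul_one, Matrix.smul_mul,
    Matrix.mul_smul, smul_sub, smul_add]
  abel

/-- In Stein form D is fixed by D ↦ (cayley M)ᵀ D (cayley N), whose iterates tend to 0. Any negative
shift would serve in place of -1. -/
theorem IsStableMatrix.sylvester_eq_zero {M N D : Matrix (Fin n) (Fin n) ℝ}
    (hM : IsStableMatrix M) (hN : IsStableMatrix N) (h : Mᵀ * D + D * N = 0) : D = 0 := by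
  have hs : (cayley (-1) M)ᵀ * D * cayley (-1) N = D := by
    have := cayley_stein (D := D) (hM.isUnit_add_smul neg_one_lt_zero)
      (hN.isUnit_add_smul neg_one_lt_zero)
    rw [h, Matrix.mul_zero, Matrix.zero_mul, smul_zero, sub_eq_zero] at this
    exact this.symm
  have hk : ∀ k, (cayley (-1) M ^ k)ᵀ * D * cayley (-1) N ^ k = D := by
    intro k
    induction k with
    | zero => simp
    | succ k ih =>
      rw [pow_succ, pow_succ', transpose_mul]
      calc _ = (cayley (-1) M)ᵀ * ((cayley (-1) M ^ k)ᵀ * D * cayley (-1) N ^ k) *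
            cayley (-1) N := by
            rw [← pow_succ', pow_succ]; simp only [Matrix.mul_assoc]
        _ = D := by rw [ih, hs]
  have := hM.tendsto_transpose_mul_mul hN neg_one_lt_zero D
  simp only [hk] at this
  exact tendsto_nhds_unique tendsto_const_nhds this

/-- The Stein form says X ⪰ Rᵀ X R; iterating, X ⪰ (R^k)ᵀ X R^k → 0. -/
theorem IsStableMatrix.posSemidef_of_lyapunov {M Q X : Matrix (Fin n) (Fin n) ℝ}
    (hM : IsStableMatrix M) (hQ : Q.PosSemidef) (h : Mᵀ * X + X * M + Q = 0) : X.PosSemidef := by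
  set R := cayley (-1) M with hR
  have hs : (X - Rᵀ * X * R).PosSemidef := by
    have hu := hM.isUnit_add_smul neg_one_lt_zero
    rw [hR, cayley_stein hu hu, eq_neg_of_add_eq_zero_left h, Matrix.mul_neg, Matrix.neg_mul,
      smul_neg, ← neg_smul]
    exact (hQ.transpose_mul_mul _).smul (by norm_num)
  have hk : ∀ k, (X - (R ^ k)ᵀ * X * R ^ k).PosSemidef := by
    intro k
    induction k with
    | zero => simpa using PosSemidef.zero
    | succ k ih =>
      have := ih.add (hs.transpose_mul_mul (R ^ k))
      rw [Matrix.mul_sub, Matrix.sub_mul, sub_add_sub_cancel] at this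
      rw [pow_succ', transpose_mul]
      simpa only [Matrix.mul_assoc] using this
  have := tendsto_const_nhds (x := X).sub (hM.tendsto_transpose_mul_mul hM neg_one_lt_zero X)
  rw [sub_zero] at this
  exact PosSemidef.of_tendsto this hk

theorem IsStableMatrix.exists_lyapunov {M Q : Matrix (Fin n) (Fin n) ℝ}
    (hM : IsStableMatrix M) (hQ : Q.PosSemidef) :
    ∃ X : Matrix (Fin n) (Fin n) ℝ, X.PosSemidef ∧ Mᵀ * X + X * M + Q = 0 := by
  have hinj : Function.Injective (LinearMap.mulLeft ℝ Mᵀ + LinearMap.mulRight ℝ M) := by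
    rw [injective_iff_map_eq_zero]
    exact fun D hD => hM.sylvester_eq_zero hM hD
  obtain ⟨X, hX⟩ := LinearMap.injective_iff_surjective.1 hinj (-Q)
  have hX' : Mᵀ * X + X * M + Q = 0 := by
    rw [← sub_neg_eq_add, ← hX]; exact sub_self _
  exact ⟨X, hM.posSemidef_of_lyapunov hQ hX', hX'⟩

open scoped ComplexOrder in
/-- A Lyapunov criterion: `M` is stable if a positive semidefinite `X` solves the Lyapunov equation
with a right-hand side that makes `M` detectable. -/
theorem isStableMatrix_of_lyapunov {M Q X K : Matrix (Fin n) (Fin n) ℝ}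
    (hX : X.PosSemidef) (hQ : Q.PosSemidef) (h : Mᵀ * X + X * M + Q = 0)
    (hK : IsStableMatrix (M + K * Q)) : IsStableMatrix M := by
  refine isStableMatrix_iff.2 fun z v hv hz => ?_
  by_contra! hre
  -- Tested on an eigenvector with Re z ≥ 0, the equation reads 2 Re z · v*Xv + v*Qv = 0. This
  -- forces Q v = 0, so v is an eigenvector of M + K Q for the same z.
  have h1 : star v ⬝ᵥ (Mᵀ * X + X * M + Q).toComplex *ᵥ v = 0 := by
    rw [h, toComplex_zero, zero_mulVec, dotProduct_zero]
  have h2 : star v ⬝ᵥ (M.toComplexᴴ * X.toComplex) *ᵥ v = star z * (star v ⬝ᵥ X.toComplex *ᵥ v) := by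
    rw [← mulVec_mulVec, dotProduct_mulVec, ← star_mulVec, hz, star_smul, smul_dotProduct,
      smul_eq_mul]
  rw [toComplex_add, toComplex_add, toComplex_mul, toComplex_mul, toComplex_transpose, add_mulVec,
    add_mulVec, dotProduct_add, dotProduct_add, h2, ← mulVec_mulVec, hz, mulVec_smul,
    dotProduct_smul, smul_eq_mul, ← add_mul] at h1
  have hX0 := Complex.nonneg_iff.1 (hX.toComplex.dotProduct_mulVec_nonneg v)
  have hQ0 := Complex.nonneg_iff.1 (hQ.toComplex.dotProduct_mulVec_nonneg v)
  have h3 := congrArg Complex.re h1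
  simp only [Complex.add_re, Complex.mul_re, Complex.star_def, Complex.conj_re, Complex.conj_im,
    Complex.add_im, ← hX0.2, mul_zero, sub_zero, Complex.zero_re] at h3
  have h4 := mul_nonneg hre hX0.1
  have hQv : Q.toComplex *ᵥ v = 0 := by
    rw [← hQ.toComplex.dotProduct_mulVec_zero_iff]
    exact Complex.ext (by rw [Complex.zero_re]; linarith [hQ0.1]) hQ0.2.symm
  have := isStableMatrix_iff.1 hK z v hv (by
    rw [toComplex_add, toComplex_mul, add_mulVec, ← mulVec_mulVec, hQv, mulVec_zero, add_zero, hz])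
  linarith

/-! ### Stabilizing solutions of algebraic Riccati equations -/

namespace Matrix

theorem PosSemidef.mulVec_eq_zero_of_add {P Q : Matrix (Fin n) (Fin n) ℝ} (hP : P.PosSemidef)
    (hQ : Q.PosSemidef) {v : Fin n → ℝ} (h : (P + Q) *ᵥ v = 0) : P *ᵥ v = 0 ∧ Q *ᵥ v = 0 := by
  have h0 : v ⬝ᵥ P *ᵥ v + v ⬝ᵥ Q *ᵥ v = 0 := by
    rw [← dotProduct_add, ← add_mulVec, h, dotProduct_zero]
  have h1 := (posSemidef_real_iff.1 hP).2 v
  have h2 := (posSemidef_real_iff.1 hQ).2 v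
  exact ⟨hP.mulVec_eq_zero (by linarith), hQ.mulVec_eq_zero (by linarith)⟩

theorem PosSemidef.mulVec_mul_eq_zero {G : Matrix (Fin n) (Fin n) ℝ} (hG : G.PosSemidef)
    {B : Matrix (Fin n) (Fin m) ℝ} {v : Fin m → ℝ} (h : (Bᵀ * G * B) *ᵥ v = 0) :
    (G * B) *ᵥ v = 0 := by
  rw [← mulVec_mulVec]
  refine hG.mulVec_eq_zero ?_
  have : v ⬝ᵥ (Bᵀ * G * B) *ᵥ v = 0 := by rw [h, dotProduct_zero]
  rwa [Matrix.mul_assoc, ← mulVec_mulVec, dotProduct_mulVec, vecMul_transpose, ← mulVec_mulVec]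
    at this

end Matrix

section Riccati

variable {A G H F K X Y : Matrix (Fin n) (Fin n) ℝ}

/-- The kernel of a sum of positive semidefinite matrices is the intersection of their kernels, so K
H + G X factors through the inhomogeneity of `h`. Output injection thus turns A - G X into A + K H,
and the Lyapunov criterion applies. -/
theorem isStableMatrix_sub_mul (hG : G.PosSemidef) (hH : H.PosSemidef)
    (hK : IsStableMatrix (A + K * H)) {P : Matrix (Fin n) (Fin n) ℝ} (hP : P.PosSemidef)
    (hX : X.PosSemidef)
    (h : (A - G * X)ᵀ * X + X * (A - G * X) + (H + Xᵀ * G * X + P) = 0) :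
    IsStableMatrix (A - G * X) := by
  have hXG := hG.transpose_mul_mul X
  obtain ⟨K', hK'⟩ : ∃ K' : Matrix (Fin n) (Fin n) ℝ, K * H + G * X = K' * (H + Xᵀ * G * X + P) := by
    refine exists_eq_mul_of_ker_le fun v hv => ?_
    have h1 := ((hH.add hXG).mulVec_eq_zero_of_add hP hv).1
    have h2 := hH.mulVec_eq_zero_of_add hXG h1
    rw [add_mulVec, hG.mulVec_mul_eq_zero h2.2, ← mulVec_mulVec, h2.1, mulVec_zero, add_zero]
  refine isStableMatrix_of_lyapunov hX ((hH.add hXG).add hP) h (K := K') ?_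
  rw [← hK']
  convert hK using 1
  abel

/-- One step of the Newton–Kleinman iteration. -/
theorem exists_kleinman_step (hG : G.PosSemidef) (hH : H.PosSemidef)
    (hK : IsStableMatrix (A + K * H)) (hF : IsStableMatrix (A + G * F)) :
    ∃ X : Matrix (Fin n) (Fin n) ℝ, X.PosSemidef ∧ IsStableMatrix (A + G * -X) ∧
      (A + G * F)ᵀ * X + X * (A + G * F) + (H + Fᵀ * G * F) = 0 ∧
      (A - G * X)ᵀ * X + X * (A - G * X) + (H + Xᵀ * G * X + (F + X)ᵀ * G * (F + X)) = 0 := by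
  obtain ⟨X, hX, h⟩ := hF.exists_lyapunov (hH.add (hG.transpose_mul_mul F))
  have h' : (A - G * X)ᵀ * X + X * (A - G * X) +
      (H + Xᵀ * G * X + (F + X)ᵀ * G * (F + X)) = 0 := by
    rw [← h]
    simp only [transpose_add, transpose_sub, transpose_mul, hX.transpose_eq, hG.transpose_eq]
    noncomm_ring
  refine ⟨X, hX, ?_, h, h'⟩
  rw [Matrix.mul_neg, ← sub_eq_add_neg]
  exact isStableMatrix_sub_mul hG hH hK (hG.transpose_mul_mul _) hX h'

/-- The Kleinman iterates decrease and stay positive semidefinite, so they converge to a solution.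
Stability may be lost in a limit; it is recovered from `isStableMatrix_sub_mul`. -/
theorem exists_posSemidef_isStabilizingSolution (hG : G.PosSemidef) (hH : H.PosSemidef)
    (hF : IsStableMatrix (A + G * F)) (hK : IsStableMatrix (A + K * H)) :
    ∃ X : Matrix (Fin n) (Fin n) ℝ, X.PosSemidef ∧ IsStabilizingSolution A G H X := by
  choose f hf0 hfs hf1 hf2 using fun F : {F // IsStableMatrix (A + G * F)} =>
    exists_kleinman_step hG hH hK F.2
  let Y : ℕ → {F // IsStableMatrix (A + G * F)} :=
    fun k => Nat.rec ⟨F, hF⟩ (fun _ F => ⟨-f F, hfs F⟩) k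
  have hY : ∀ k, (Y (k + 1)).1 = -f (Y k) := fun k => rfl
  have hrec : ∀ k, (A - G * f (Y k))ᵀ * f (Y (k + 1)) + f (Y (k + 1)) * (A - G * f (Y k)) +
      (H + (f (Y k))ᵀ * G * f (Y k)) = 0 := by
    intro k
    have := hf1 (Y (k + 1))
    simpa only [hY, Matrix.mul_neg, transpose_neg, Matrix.neg_mul, neg_neg, ← sub_eq_add_neg]
      using this
  have hanti : ∀ k, (f (Y k) - f (Y (k + 1))).PosSemidef := by
    intro k
    have hs := hfs (Y k)
    rw [Matrix.mul_neg, ← sub_eq_add_neg] at hs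
    -- Subtracting the two Lyapunov equations with the same closed-loop matrix leaves exactly the
    -- square completed in `hf2`.
    refine hs.posSemidef_of_lyapunov (hG.transpose_mul_mul ((Y k).1 + f (Y k))) ?_
    rw [← sub_eq_zero.2 ((hf2 (Y k)).trans (hrec k).symm)]
    noncomm_ring
  obtain ⟨X, hX⟩ := exists_tendsto_of_posSemidef_antitone (fun k => hf0 (Y k)) hanti
  have hX0 : X.PosSemidef := PosSemidef.of_tendsto hX fun k => hf0 (Y k)
  have hlim : (A - G * X)ᵀ * X + X * (A - G * X) + (H + Xᵀ * G * X) = 0 := by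
    have hc : Continuous fun P : Matrix (Fin n) (Fin n) ℝ × Matrix (Fin n) (Fin n) ℝ =>
        (A - G * P.1)ᵀ * P.2 + P.2 * (A - G * P.1) + (H + P.1ᵀ * G * P.1) := by fun_prop
    have := (hc.tendsto (X, X)).comp (hX.prodMk_nhds ((tendsto_add_atTop_iff_nat 1).2 hX))
    refine tendsto_nhds_unique (this.congr fun k => hrec k) tendsto_const_nhds
  refine ⟨X, hX0, ?_, isStableMatrix_sub_mul hG hH hK .zero hX0 (by rw [add_zero]; exact hlim)⟩
  rw [← hlim]
  simp only [transpose_sub, transpose_mul, hX0.transpose_eq, hG.transpose_eq]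
  noncomm_ring

/-- Y - X solves a homogeneous Sylvester equation with the stable matrices A - G X and A - G Y.
Symmetry is needed of X alone, so uniqueness holds among all real matrices. -/
theorem IsStabilizingSolution.eq (hG : G.PosSemidef) (hX0 : X.PosSemidef)
    (hX : IsStabilizingSolution A G H X) (hY : IsStabilizingSolution A G H Y) : Y = X := by
  refine sub_eq_zero.1 (hX.2.sylvester_eq_zero hY.2 ?_)
  rw [← sub_eq_zero.2 (hY.1.trans hX.1.symm)]
  simp only [transpose_sub, transpose_mul, hX0.transpose_eq, hG.transpose_eq]
  noncomm_ring

/-- Riccati equations are invariant under translation by a symmetric matrix. -/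
theorem isStabilizingSolution_add_iff (hG : G.PosSemidef) (hX : X.PosSemidef) :
    IsStabilizingSolution A G H (X + Y) ↔
      IsStabilizingSolution (A - G * X) G (Aᵀ * X + X * A - X * G * X + H) Y := by
  unfold IsStabilizingSolution
  rw [sub_sub, ← Matrix.mul_add]
  refine and_congr_left fun _ => ?_
  rw [show Aᵀ * (X + Y) + (X + Y) * A - (X + Y) * G * (X + Y) + H =
    (A - G * X)ᵀ * Y + Y * (A - G * X) - Y * G * Y + (Aᵀ * X + X * A - X * G * X + H) by
      simp only [transpose_sub, transpose_mul, hX.transpose_eq, hG.transpose_eq]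
      noncomm_ring]

/-- The dual Riccati equation also has a positive semidefinite stabilizing solution. -/
theorem exists_posSemidef_dual (hG : G.PosSemidef) (hH : H.PosSemidef)
    (hF : IsStableMatrix (A + G * F)) (hK : IsStableMatrix (A + K * H)) :
    ∃ X : Matrix (Fin n) (Fin n) ℝ, X.PosSemidef ∧ IsStabilizingSolution Aᵀ H G X := by
  refine exists_posSemidef_isStabilizingSolution (F := Kᵀ) (K := Fᵀ) hH hG ?_ ?_
  · simpa [hH.transpose_eq] using hK.transpose
  · simpa [hG.transpose_eq] using hF.transpose

end Riccati

/-! ### Coefficients of the frozen Riccati equations -/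

namespace SCARE

variable {n m r : ℕ} {d : SCARE n m r} {X : Matrix (Fin n) (Fin n) ℝ}

theorem posDef_Rc (hR : d.R.PosDef) (hX : X.PosSemidef) : (d.Rc X).PosDef :=
  hR.add_posSemidef (posSemidef_sum _ fun i _ => hX.transpose_mul_mul (d.B₀ i))

theorem posSemidef_Gc (hR : d.R.PosDef) (hX : X.PosSemidef) : (d.Gc X).PosSemidef :=
  (posDef_Rc hR hX).inv.posSemidef.mul_mul_transpose d.B

theorem posSemidef_schurQ (hR : d.R.PosDef)
    (hQLR : (Matrix.fromBlocks d.Q d.L d.Lᵀ d.R).PosSemidef) : d.schurQ.PosSemidef := by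
  have := hR.isUnit.invertible
  have h := (PosDef.fromBlocks₂₂ d.Q d.L hR).1
  rw [conjTranspose_eq_transpose_of_trivial] at h
  exact h hQLR

theorem transpose_Lc (hX : X.PosSemidef) :
    (d.Lc X)ᵀ = d.Lᵀ + ∑ i, (d.B₀ i)ᵀ * X * d.A₀ i := by
  simp [Lc, Pi12, transpose_sum, hX.transpose_eq, Matrix.mul_assoc]

/-- `H_c(X)` exceeds `Q - L R⁻¹ Lᵀ` by a sum of positive semidefinite matrices. -/
theorem Hc_eq (hR : d.R.PosDef) (hX : X.PosSemidef) {F : Matrix (Fin m) (Fin n) ℝ}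
    (hF : F = (d.Rc X)⁻¹ * (d.Lc X)ᵀ) :
    d.Hc X = d.schurQ + ((F - d.R⁻¹ * d.Lᵀ)ᵀ * d.R * (F - d.R⁻¹ * d.Lᵀ) +
      ∑ i, (d.A₀ i - d.B₀ i * F)ᵀ * X * (d.A₀ i - d.B₀ i * F)) := by
  have hRc := posDef_Rc hR hX
  have hRcu := (isUnit_iff_isUnit_det _).1 hRc.isUnit
  have hRu := (isUnit_iff_isUnit_det _).1 hR.isUnit
  have hRT : (d.R⁻¹)ᵀ = d.R⁻¹ := hR.inv.posSemidef.transpose_eq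
  have hLF : d.Lc X * (d.Rc X)⁻¹ * (d.Lc X)ᵀ = d.Lc X * F := by rw [hF, Matrix.mul_assoc]
  have hFT : Fᵀ = d.Lc X * (d.Rc X)⁻¹ := by
    rw [hF, transpose_mul, transpose_transpose, hRc.inv.posSemidef.transpose_eq]
  have hRF : d.Rc X * F = (d.Lc X)ᵀ := by rw [hF, mul_nonsing_inv_cancel_left _ _ hRcu]
  -- Adding the vanishing term FᵀL_cᵀ - FᵀR_cF makes the expression quadratic in F, ready to be
  -- matched with the expanded squares `h1` and `h2`.
  have hLF' : d.Lc X * F = d.Lc X * F + Fᵀ * (d.Lc X)ᵀ - Fᵀ * (d.Rc X * F) := by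
    rw [hRF]; abel
  have h1 : (F - d.R⁻¹ * d.Lᵀ)ᵀ * d.R * (F - d.R⁻¹ * d.Lᵀ) =
      Fᵀ * d.R * F - d.L * F - Fᵀ * d.Lᵀ + d.L * d.R⁻¹ * d.Lᵀ := by
    simp only [transpose_sub, transpose_mul, transpose_transpose, hRT, Matrix.sub_mul,
      Matrix.mul_sub, Matrix.mul_assoc, mul_nonsing_inv_cancel_left _ _ hRu,
      nonsing_inv_mul_cancel_left _ _ hRu]
    abel
  have h2 : ∑ i, (d.A₀ i - d.B₀ i * F)ᵀ * X * (d.A₀ i - d.B₀ i * F) =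
      d.Pi11 X - d.Pi12 X * F - Fᵀ * (∑ i, (d.B₀ i)ᵀ * X * d.A₀ i) + Fᵀ * d.Pi22 X * F := by
    simp only [Pi11, Pi12, Pi22, Matrix.sum_mul, Matrix.mul_sum, ← Finset.sum_sub_distrib,
      ← Finset.sum_add_distrib]
    refine Finset.sum_congr rfl fun i _ => ?_
    simp only [transpose_sub, transpose_mul, Matrix.sub_mul, Matrix.mul_sub, Matrix.mul_assoc]
    abel
  rw [h1, h2, Hc, hLF, hLF', transpose_Lc hX, Lc, Rc, Qc, schurQ]
  simp only [Matrix.add_mul, Matrix.mul_add, Matrix.mul_assoc]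
  abel

theorem exists_Hc_eq (hR : d.R.PosDef) (hX : X.PosSemidef) :
    ∃ P : Matrix (Fin n) (Fin n) ℝ, P.PosSemidef ∧ d.Hc X = d.schurQ + P :=
  ⟨_, (hR.posSemidef.transpose_mul_mul _).add
    (posSemidef_sum _ fun _ _ => hX.transpose_mul_mul _), Hc_eq hR hX rfl⟩

theorem posSemidef_Hc (hR : d.R.PosDef)
    (hQLR : (Matrix.fromBlocks d.Q d.L d.Lᵀ d.R).PosSemidef) (hX : X.PosSemidef) :
    (d.Hc X).PosSemidef := by
  obtain ⟨P, hP, h⟩ := exists_Hc_eq hR hX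
  rw [h]
  exact (posSemidef_schurQ hR hQLR).add hP

/-- Definiteness of R_c⁻¹ gives ker G_c ⊆ ker Bᵀ, hence B = G_c Mᵀ: any feedback through B is one
through G_c, including the one cancelling A_c - A. -/
theorem exists_isStableMatrix_Ac_add_Gc_mul (hR : d.R.PosDef) (hX : X.PosSemidef)
    (hAB : IsStabilizablePair d.A d.B) :
    ∃ F : Matrix (Fin n) (Fin n) ℝ, IsStableMatrix (d.Ac X + d.Gc X * F) := by
  obtain ⟨F, hF⟩ := hAB
  have hRi := (posDef_Rc hR hX).inv
  obtain ⟨M, hM⟩ : ∃ M : Matrix (Fin m) (Fin n) ℝ, d.Bᵀ = M * d.Gc X := by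
    refine exists_eq_mul_of_ker_le fun v hv => ?_
    have h1 := hRi.posSemidef.mulVec_mul_eq_zero (B := d.Bᵀ) (v := v)
      (by rw [transpose_transpose]; exact hv)
    rw [← one_mulVec (d.Bᵀ *ᵥ v), ← mul_nonsing_inv _
      ((isUnit_iff_isUnit_det _).1 (posDef_Rc hR hX).isUnit), ← mulVec_mulVec,
      mulVec_mulVec _ (d.Rc X)⁻¹, h1, mulVec_zero]
  have hB : d.B = d.Gc X * Mᵀ := by
    rw [← transpose_transpose d.B, hM, transpose_mul, (posSemidef_Gc hR hX).transpose_eq]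
  refine ⟨Mᵀ * (F + (d.Rc X)⁻¹ * (d.Lc X)ᵀ), ?_⟩
  rw [← Matrix.mul_assoc, ← hB, Ac, Matrix.mul_add, Matrix.mul_assoc, sub_add_add_cancel]
  exact hF

/-- On ker H_c the matrix Q - L R⁻¹ Lᵀ vanishes, hence by `hker` so does L_cᵀ. The injection that
undoes A_c - A and adds K (Q - L R⁻¹ Lᵀ) therefore factors through H_c. -/
theorem exists_isStableMatrix_Ac_add_mul_Hc (hR : d.R.PosDef)
    (hQLR : (Matrix.fromBlocks d.Q d.L d.Lᵀ d.R).PosSemidef) (hX : X.PosSemidef)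
    (hker : ∀ v : Fin n → ℝ, d.schurQ *ᵥ v = 0 → d.Lᵀ *ᵥ v = 0 ∧ ∀ i, d.A₀ i *ᵥ v = 0)
    (hQA : IsDetectablePair d.schurQ d.A) :
    ∃ K : Matrix (Fin n) (Fin n) ℝ, IsStableMatrix (d.Ac X + K * d.Hc X) := by
  obtain ⟨K, hK⟩ := hQA
  obtain ⟨P, hP, hH⟩ := exists_Hc_eq hR hX
  obtain ⟨K', hK'⟩ : ∃ K' : Matrix (Fin n) (Fin n) ℝ,
      d.B * (d.Rc X)⁻¹ * (d.Lc X)ᵀ + K * d.schurQ = K' * d.Hc X := by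
    refine exists_eq_mul_of_ker_le fun v hv => ?_
    rw [hH] at hv
    have h1 := ((posSemidef_schurQ hR hQLR).mulVec_eq_zero_of_add hP hv).1
    obtain ⟨hL, hA⟩ := hker v h1
    have hLc : (d.Lc X)ᵀ *ᵥ v = 0 := by
      rw [transpose_Lc hX, add_mulVec, hL, zero_add, sum_mulVec]
      exact Finset.sum_eq_zero fun i _ => by rw [← mulVec_mulVec, hA, mulVec_zero]
    rw [add_mulVec, ← mulVec_mulVec, hLc, mulVec_zero, zero_add, ← mulVec_mulVec, h1, mulVec_zero]
  refine ⟨K', ?_⟩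
  rw [← hK', Ac, ← add_assoc, sub_add_cancel]
  exact hK

theorem residual_eq (hR : d.R.PosDef) (hX : X.PosSemidef) :
    d.residual X = (d.Ac X)ᵀ * X + X * d.Ac X - X * d.Gc X * X + d.Hc X := by
  have hRi : ((d.Rc X)⁻¹)ᵀ = (d.Rc X)⁻¹ := (posDef_Rc hR hX).inv.posSemidef.transpose_eq
  rw [residual, show X * d.B + d.L + d.Pi12 X = X * d.B + d.Lc X by rw [Lc, add_assoc],
    show d.R + d.Pi22 X = d.Rc X from rfl, Ac, Gc, Hc, Qc]
  simp only [transpose_sub, transpose_add, transpose_mul, transpose_transpose, hRi,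
    hX.transpose_eq, Matrix.add_mul, Matrix.mul_add, Matrix.sub_mul, Matrix.mul_sub,
    Matrix.mul_assoc]
  abel

end SCARE

/-! ### Convergence of the doubling algorithm -/

namespace SDA

variable {n : ℕ}

/-- `X` and `-Y` are positive semidefinite. -/
structure Definite (s : SDAState n) : Prop where
  X : s.X.PosSemidef
  Y : (-s.Y).PosSemidef

theorem one_sub_mul_eq (X Y : Matrix (Fin n) (Fin n) ℝ) : 1 - Y * X = 1 + -Y * X := by
  rw [Matrix.neg_mul, sub_eq_add_neg]

namespace Definite

variable {s : SDAState n} (hs : Definite s)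
include hs

theorem isUnit : IsUnit (1 - s.Y * s.X) := by
  rw [one_sub_mul_eq]
  exact isUnit_one_add_mul hs.Y hs.X

theorem isUnit_det : IsUnit (1 - s.Y * s.X).det := (isUnit_iff_isUnit_det _).1 hs.isUnit

theorem transpose_Y : s.Yᵀ = s.Y := by
  have := hs.Y.transpose_eq
  rwa [transpose_neg, neg_inj] at this

theorem transpose_one_sub_mul : (1 - s.Y * s.X)ᵀ = 1 - s.X * s.Y := by
  rw [transpose_sub, transpose_one, transpose_mul, hs.X.transpose_eq, hs.transpose_Y]

theorem X_mul_inv_comm : s.X * (1 - s.Y * s.X)⁻¹ = (1 - s.X * s.Y)⁻¹ * s.X := by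
  rw [show 1 - s.X * s.Y = 1 + s.X * -s.Y by rw [Matrix.mul_neg, sub_eq_add_neg],
    one_sub_mul_eq, mul_inv_one_add_mul_comm hs.Y hs.X]

theorem Y_mul_inv_comm : s.Y * (1 - s.X * s.Y)⁻¹ = (1 - s.Y * s.X)⁻¹ * s.Y := by
  have := mul_inv_one_add_mul_comm hs.X hs.Y
  rwa [Matrix.mul_neg, ← sub_eq_add_neg, ← one_sub_mul_eq, Matrix.neg_mul, Matrix.mul_neg,
    neg_inj] at this

theorem step : Definite (step s) where
  X := by
    refine hs.X.add ?_
    rw [Matrix.mul_assoc s.Eᵀ, one_sub_mul_eq]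
    exact (posSemidef_mul_inv_one_add_mul hs.Y hs.X).transpose_mul_mul s.E
  Y := by
    have h := (posSemidef_mul_inv_one_add_mul hs.X hs.Y).mul_mul_transpose s.E
    rw [Matrix.mul_neg, ← sub_eq_add_neg, Matrix.neg_mul, hs.Y_mul_inv_comm] at h
    have h' := hs.Y.add h
    rwa [Matrix.mul_neg, Matrix.neg_mul, ← neg_add, ← Matrix.mul_assoc] at h'

/-- One doubling step squares the closed-loop matrix `T`. -/
theorem step_invariant {X T : Matrix (Fin n) (Fin n) ℝ}
    (hE : s.E = (1 - s.Y * X) * T) (hX : X - s.X = s.Eᵀ * X * T) :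
    (SDA.step s).E = (1 - (SDA.step s).Y * X) * (T * T) ∧
      X - (SDA.step s).X = (SDA.step s).Eᵀ * X * (T * T) := by
  have hW := hs.isUnit_det
  have hW' : IsUnit (1 - s.X * s.Y).det := by
    rw [← hs.transpose_one_sub_mul, det_transpose]; exact hW
  have hWT : ((1 - s.Y * s.X)⁻¹)ᵀ = (1 - s.X * s.Y)⁻¹ := by
    rw [transpose_nonsing_inv, hs.transpose_one_sub_mul]
  constructor
  -- With 1 - Y X = (1 - Y X_i) - Y (X - X_i), the inverse cancels the first part and `hX` rewrites
  -- the second.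
  · calc s.E * (1 - s.Y * s.X)⁻¹ * s.E
        = s.E * (1 - s.Y * s.X)⁻¹ * ((1 - s.Y * s.X) * T - s.Y * (X - s.X) * T) := by
          rw [hE]; noncomm_ring
      _ = s.E * T - s.E * (1 - s.Y * s.X)⁻¹ * s.Y * (X - s.X) * T := by
          rw [Matrix.mul_sub, ← Matrix.mul_assoc _ (1 - s.Y * s.X),
            nonsing_inv_mul_cancel_right _ _ hW]
          simp only [Matrix.mul_assoc]
      _ = (1 - s.Y * X) * T * T - s.E * (1 - s.Y * s.X)⁻¹ * s.Y * (s.Eᵀ * X * T) * T := by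
          rw [hX, ← hE]
      _ = (1 - (s.Y + s.E * (1 - s.Y * s.X)⁻¹ * s.Y * s.Eᵀ) * X) * (T * T) := by
          noncomm_ring
  · have h1 : X * T - s.X * (1 - s.Y * s.X)⁻¹ * s.E = (1 - s.X * s.Y)⁻¹ * (X - s.X) * T := by
      calc X * T - s.X * (1 - s.Y * s.X)⁻¹ * s.E
          = (1 - s.X * s.Y)⁻¹ * ((1 - s.X * s.Y) * (X * T) - s.X * s.E) := by
            rw [hs.X_mul_inv_comm, Matrix.mul_sub, nonsing_inv_mul_cancel_left _ _ hW',
              Matrix.mul_assoc]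
        _ = (1 - s.X * s.Y)⁻¹ * (X - s.X) * T := by
            rw [Matrix.mul_assoc]; congr 1; rw [hE]; noncomm_ring
    calc X - (s.X + s.Eᵀ * s.X * (1 - s.Y * s.X)⁻¹ * s.E)
        = s.Eᵀ * (X * T - s.X * (1 - s.Y * s.X)⁻¹ * s.E) := by
          rw [← sub_sub, hX]; noncomm_ring
      _ = s.Eᵀ * ((1 - s.X * s.Y)⁻¹ * (s.Eᵀ * X * T) * T) := by rw [h1, hX]
      _ = (s.E * (1 - s.Y * s.X)⁻¹ * s.E)ᵀ * X * (T * T) := by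
          rw [transpose_mul, transpose_mul, hWT]
          simp only [Matrix.mul_assoc]

end Definite

/-! #### Initialization -/

section Init

variable {A G H : Matrix (Fin n) (Fin n) ℝ} {γ : ℝ}

/-- Exhibits S, up to sign, as (1 + product of two positive semidefinite matrices) times an
invertible matrix. -/
theorem S_eq (hA : IsUnit (A + γ • (1 : Matrix (Fin n) (Fin n) ℝ))) :
    S A G H γ =
      -((1 + H * ((A + γ • 1)⁻¹ * G * ((A + γ • 1)⁻¹)ᵀ)) * (A + γ • 1)ᵀ) := by
  rw [isUnit_iff_isUnit_det] at hA
  have h : ((A + γ • 1)⁻¹)ᵀ * (A + γ • 1)ᵀ = 1 := by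
    rw [← transpose_mul, mul_nonsing_inv _ hA, transpose_one]
  rw [S, Matrix.add_mul, Matrix.one_mul, Matrix.mul_assoc H _ (A + γ • 1)ᵀ,
    Matrix.mul_assoc _ _ (A + γ • 1)ᵀ, h, Matrix.mul_one, neg_add, ← sub_eq_add_neg,
    Matrix.mul_assoc]

theorem isUnit_S (hG : G.PosSemidef) (hH : H.PosSemidef)
    (hA : IsUnit (A + γ • (1 : Matrix (Fin n) (Fin n) ℝ))) : IsUnit (S A G H γ) := by
  rw [S_eq hA]
  exact ((isUnit_one_add_mul hH (hG.mul_mul_transpose _)).mul ((isUnit_transpose _).2 hA)).neg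

theorem inv_S_eq (hG : G.PosSemidef) (hH : H.PosSemidef)
    (hA : IsUnit (A + γ • (1 : Matrix (Fin n) (Fin n) ℝ))) :
    (S A G H γ)⁻¹ =
      -(((A + γ • 1)⁻¹)ᵀ * (1 + H * ((A + γ • 1)⁻¹ * G * ((A + γ • 1)⁻¹)ᵀ))⁻¹) := by
  have h : (A + γ • 1)ᵀ * ((A + γ • 1)⁻¹)ᵀ = 1 := by
    rw [← transpose_mul, nonsing_inv_mul _ ((isUnit_iff_isUnit_det _).1 hA), transpose_one]
  refine inv_eq_right_inv ?_
  rw [S_eq hA, neg_mul_neg, ← Matrix.mul_assoc, Matrix.mul_assoc _ (A + γ • 1)ᵀ, h, Matrix.mul_one,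
    mul_nonsing_inv _ (isUnit_one_add_mul_det hH (hG.mul_mul_transpose _))]

/-- The last factor in the definition of Y_0 is S + 2γ, so the leading term cancels. -/
theorem init_Y_eq (hG : G.PosSemidef) (hH : H.PosSemidef)
    (hA : IsUnit (A + γ • (1 : Matrix (Fin n) (Fin n) ℝ))) :
    (init A G H γ).Y = -((2 * γ) • ((A + γ • 1)⁻¹ * G * (S A G H γ)⁻¹)) := by
  have hS := (isUnit_iff_isUnit_det _).1 (isUnit_S hG hH hA)
  have h : -(H * (A + γ • 1)⁻¹ * G) - (A - γ • 1)ᵀ = S A G H γ + (2 * γ) • 1 := by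
    rw [S, two_mul, add_smul]
    simp only [transpose_add, transpose_sub, transpose_smul, transpose_one]
    abel
  rw [init, h, Matrix.mul_add, nonsing_inv_mul_cancel_right _ _ hS, Matrix.mul_smul,
    Matrix.mul_one, sub_add_cancel_left]

theorem definite_init (hG : G.PosSemidef) (hH : H.PosSemidef) (hγ : γ < 0)
    (hA : IsUnit (A + γ • (1 : Matrix (Fin n) (Fin n) ℝ))) : Definite (init A G H γ) := by
  have hG' := hG.mul_mul_transpose (A + γ • 1)⁻¹
  constructor
  · have h := ((posSemidef_mul_inv_one_add_mul hG' hH).transpose_mul_mul (A + γ • 1)⁻¹).smul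
      (a := -(2 * γ)) (by linarith)
    rw [mul_inv_one_add_mul_comm hG' hH] at h
    convert h using 1
    rw [init, inv_S_eq hG hH hA]
    simp only [Matrix.neg_mul, smul_neg, neg_smul, Matrix.mul_assoc]
  · have h := (posSemidef_mul_inv_one_add_mul hH hG').smul (a := -(2 * γ)) (by linarith)
    convert h using 1
    rw [init_Y_eq hG hH hA, inv_S_eq hG hH hA]
    simp only [Matrix.mul_neg, smul_neg, neg_smul, Matrix.mul_assoc, neg_neg]

theorem init_invariant (hG : G.PosSemidef) (hH : H.PosSemidef) (hγ : γ < 0)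
    (hA : IsUnit (A + γ • (1 : Matrix (Fin n) (Fin n) ℝ))) {X : Matrix (Fin n) (Fin n) ℝ}
    (hX : IsStabilizingSolution A G H X) :
    (init A G H γ).E = (1 - (init A G H γ).Y * X) * cayley γ (A - G * X) ∧
      X - (init A G H γ).X = (init A G H γ).Eᵀ * X * cayley γ (A - G * X) := by
  have hYT := (definite_init hG hH hγ hA).transpose_Y
  rw [init_Y_eq hG hH hA, transpose_neg, transpose_smul, transpose_mul, transpose_mul,
    hG.transpose_eq] at hYT
  -- By symmetry Y_0 is replaced by its transpose, so that S⁻ᵀ appears on the left as in E_0.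
  rw [init_Y_eq hG hH hA, ← hYT]
  have hu := (isUnit_iff_isUnit_det _).1 (hX.2.isUnit_add_smul hγ)
  have hS := (isUnit_iff_isUnit_det _).1 (isUnit_S hG hH hA)
  have hA' := (isUnit_iff_isUnit_det _).1 hA
  set a := A + γ • (1 : Matrix (Fin n) (Fin n) ℝ) with ha
  set T := (S A G H γ)⁻¹ with hT
  set P := a⁻¹ with hP
  have hac : A - G * X + γ • 1 = a - G * X := by rw [ha]; abel
  rw [hac] at hu
  rw [cayley, hac]
  set u := (a - G * X)⁻¹
  have hPa : P * a = 1 := nonsing_inv_mul _ hA'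
  have hau : a * u = 1 + G * X * u := by
    rw [← mul_nonsing_inv _ hu, Matrix.sub_mul, sub_add_cancel]
  have huP : u = P + P * (G * X * u) := by
    calc u = P * (a * u) := by rw [← Matrix.mul_assoc, hPa, Matrix.one_mul]
      _ = P + P * (G * X * u) := by rw [hau, Matrix.mul_add, Matrix.mul_one]
  have hric : aᵀ * X + H = (2 * γ) • X - X * (a - G * X) := by
    rw [← sub_eq_zero, ← hX.1, ha, two_mul, add_smul]
    simp only [transpose_add, transpose_smul, transpose_one, Matrix.add_mul, Matrix.mul_sub,
      Matrix.mul_add, Matrix.smul_mul, Matrix.mul_smul, Matrix.one_mul, Matrix.mul_one,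
      Matrix.mul_assoc]
    abel
  have hXR : X * (1 - (2 * γ) • u) = -((aᵀ * X + H) * u) := by
    rw [hric, Matrix.sub_mul, Matrix.mul_assoc, mul_nonsing_inv _ hu, Matrix.mul_sub,
      Matrix.mul_smul, Matrix.smul_mul]
    abel
  have hST : S A G H γ * T = 1 := mul_nonsing_inv _ hS
  have hTS : T * S A G H γ = 1 := nonsing_inv_mul _ hS
  have hSe : S A G H γ = -aᵀ - H * P * G := rfl
  constructor
  · have h1 : G * Pᵀ * (X * (1 - (2 * γ) • u)) = (S A G H γ)ᵀ * u + 1 := by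
      have hPT : Pᵀ * aᵀ = 1 := by
        rw [← transpose_mul, mul_nonsing_inv _ hA', transpose_one]
      rw [hXR, hSe]
      simp only [transpose_sub, transpose_neg, transpose_mul, transpose_transpose,
        hG.transpose_eq, hH.transpose_eq]
      calc G * Pᵀ * -((aᵀ * X + H) * u)
          = -(G * (Pᵀ * aᵀ) * X * u) - G * (Pᵀ * H) * u := by
            rw [Matrix.mul_neg, Matrix.add_mul, Matrix.mul_add, neg_add, ← sub_eq_add_neg]
            simp only [Matrix.mul_assoc]
        _ = (-(1 + G * X * u) - G * (Pᵀ * H) * u) + 1 := by rw [hPT]; noncomm_ring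
        _ = (-a - G * (Pᵀ * H)) * u + 1 := by rw [← hau]; noncomm_ring
    have h2 : Tᵀ * (G * Pᵀ * (X * (1 - (2 * γ) • u))) = u + Tᵀ := by
      rw [h1, Matrix.mul_add, ← Matrix.mul_assoc, ← transpose_mul, hST, transpose_one,
        Matrix.one_mul, Matrix.mul_one]
    change 1 + (2 * γ) • Tᵀ = _
    rw [Matrix.neg_mul, sub_neg_eq_add, Matrix.add_mul, Matrix.one_mul, Matrix.smul_mul, Matrix.smul_mul]
    simp only [Matrix.mul_assoc] at h2 ⊢
    rw [h2, smul_add]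
    abel
  · have h1 : S A G H γ * (X * u) = H * P + X * (1 - (2 * γ) • u) := by
      have h3 : H * u = H * P + H * (P * (G * X * u)) := by rw [← Matrix.mul_add, ← huP]
      rw [hXR, hSe, Matrix.add_mul, h3]
      noncomm_ring
    have h2 : X * u = T * (H * P) + T * (X * (1 - (2 * γ) • u)) := by
      rw [← Matrix.mul_add, ← h1, ← Matrix.mul_assoc, hTS, Matrix.one_mul]
    change X - (2 * γ) • (T * H * P) = (1 + (2 * γ) • Tᵀ)ᵀ * X * (1 - (2 * γ) • u)
    have h3 : (2 * γ) • (X * u) = X - X * (1 - (2 * γ) • u) := by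
      rw [Matrix.mul_sub, Matrix.mul_one, Matrix.mul_smul, sub_sub_cancel]
    rw [transpose_add, transpose_smul, transpose_transpose, transpose_one, Matrix.mul_assoc _ X,
      Matrix.add_mul, Matrix.one_mul, Matrix.smul_mul, Matrix.mul_assoc T H P,
      sub_eq_iff_eq_add, add_assoc, ← smul_add, add_comm (T * _), ← h2, h3, add_sub_cancel]

end Init

/-! #### Duality -/

/-- The state of the doubling algorithm for the dual Riccati equation. -/
def dual (s : SDAState n) : SDAState n where
  E := s.Eᵀ
  X := -s.Y
  Y := -s.X

/-- Duality turns bounds for the X-iterates into bounds for -Y. -/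
theorem step_dual {s : SDAState n} (hs : Definite s) : step (dual s) = dual (step s) := by
  have hW : ((1 - s.Y * s.X)⁻¹)ᵀ = (1 - s.X * s.Y)⁻¹ := by
    rw [transpose_nonsing_inv, hs.transpose_one_sub_mul]
  have h1 := hs.X_mul_inv_comm
  have h2 := hs.Y_mul_inv_comm
  simp only [step, dual, neg_mul_neg, transpose_mul, transpose_transpose, hW, SDAState.mk.injEq]
  refine ⟨by simp only [Matrix.mul_assoc], ?_, ?_⟩
  · rw [Matrix.mul_neg, Matrix.neg_mul, Matrix.neg_mul, neg_add, Matrix.mul_assoc s.E, h2]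
    simp only [Matrix.mul_assoc]
  · rw [Matrix.mul_neg, Matrix.neg_mul, neg_add, Matrix.mul_assoc s.Eᵀ _ s.X, ← h1]
    simp only [Matrix.mul_assoc]

/-! ### Definiteness, duality and invariants of all iterates -/

section Iter

variable {A G H : Matrix (Fin n) (Fin n) ℝ} {γ : ℝ}

theorem isUnit_transpose_add_smul (hA : IsUnit (A + γ • (1 : Matrix (Fin n) (Fin n) ℝ))) :
    IsUnit (Aᵀ + γ • (1 : Matrix (Fin n) (Fin n) ℝ)) := by
  simpa using (isUnit_transpose _).2 hA

theorem S_transpose (hG : G.PosSemidef) (hH : H.PosSemidef) : S Aᵀ H G γ = (S A G H γ)ᵀ := by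
  have h : (Aᵀ + γ • 1)⁻¹ = ((A + γ • 1)⁻¹)ᵀ := by
    rw [transpose_nonsing_inv]; simp
  rw [S, S, h]
  simp [hG.transpose_eq, hH.transpose_eq, Matrix.mul_assoc]

variable (hG : G.PosSemidef) (hH : H.PosSemidef) (hγ : γ < 0)
  (hA : IsUnit (A + γ • (1 : Matrix (Fin n) (Fin n) ℝ)))
include hG hH

include hγ hA

theorem init_dual : init Aᵀ H G γ = dual (init A G H γ) := by
  have hA' := isUnit_transpose_add_smul hA
  have hS := S_transpose (A := A) (γ := γ) hG hH
  have hX := (definite_init hG hH hγ hA).X.transpose_eq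
  have hY := (definite_init hG hH hγ hA).transpose_Y
  have hY1 := init_Y_eq hG hH hA
  have hY2 := init_Y_eq hH hG hA'
  have e1 : (init Aᵀ H G γ).E = (dual (init A G H γ)).E := by
    simp [init, dual, hS, transpose_nonsing_inv]
  have e2 : (init Aᵀ H G γ).X = (dual (init A G H γ)).X := by
    rw [dual, ← hY, hY1]
    simp [init, hS, transpose_nonsing_inv, hG.transpose_eq, Matrix.mul_assoc]
  have e3 : (init Aᵀ H G γ).Y = (dual (init A G H γ)).Y := by
    rw [dual, ← hX, hY2]
    simp [init, hS, transpose_nonsing_inv, hH.transpose_eq, Matrix.mul_assoc]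
  cases h1 : init Aᵀ H G γ
  cases h2 : dual (init A G H γ)
  rw [h1, h2] at e1 e2 e3
  simp_all

theorem definite_iter : ∀ i, Definite (iter A G H γ i)
  | 0 => definite_init hG hH hγ hA
  | i + 1 => (definite_iter i).step

theorem iter_dual : ∀ i, iter Aᵀ H G γ i = dual (iter A G H γ i)
  | 0 => init_dual hG hH hγ hA
  | i + 1 => by
    rw [iter, iter_dual i, step_dual (definite_iter hG hH hγ hA i), iter]

theorem noBreakdown : NoBreakdown A G H γ :=
  ⟨hA, isUnit_S hG hH hA, fun i => (definite_iter hG hH hγ hA i).isUnit⟩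

variable {X : Matrix (Fin n) (Fin n) ℝ} (hX0 : X.PosSemidef) (hX : IsStabilizingSolution A G H X)
include hX

theorem iter_invariant : ∀ i,
    (iter A G H γ i).E = (1 - (iter A G H γ i).Y * X) * cayley γ (A - G * X) ^ 2 ^ i ∧
      X - (iter A G H γ i).X = (iter A G H γ i).Eᵀ * X * cayley γ (A - G * X) ^ 2 ^ i
  | 0 => by simpa [iter] using init_invariant hG hH hγ hA hX
  | i + 1 => by
    rw [pow_succ 2, mul_two, pow_add]
    exact (definite_iter hG hH hγ hA i).step_invariant (iter_invariant i).1 (iter_invariant i).2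

include hX0

/-- Eliminating E_i between the two invariants shows the error as a sum of two positive semidefinite
terms. -/
theorem sub_iter_X_eq (i : ℕ) :
    X - (iter A G H γ i).X = (cayley γ (A - G * X) ^ 2 ^ i)ᵀ * X * cayley γ (A - G * X) ^ 2 ^ i +
      (X * cayley γ (A - G * X) ^ 2 ^ i)ᵀ * -(iter A G H γ i).Y *
        (X * cayley γ (A - G * X) ^ 2 ^ i) := by
  obtain ⟨h1, h2⟩ := iter_invariant hG hH hγ hA hX i
  rw [h2, h1]
  simp only [transpose_mul, transpose_sub, transpose_one, hX0.transpose_eq,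
    (definite_iter hG hH hγ hA i).transpose_Y]
  generalize cayley γ (A - G * X) ^ 2 ^ i = R
  noncomm_ring

theorem posSemidef_sub_iter_X (i : ℕ) : (X - (iter A G H γ i).X).PosSemidef := by
  rw [sub_iter_X_eq hG hH hγ hA hX0 hX]
  exact (hX0.transpose_mul_mul _).add ((definite_iter hG hH hγ hA i).Y.transpose_mul_mul _)

/-- From 0 ⪯ X_i ⪯ X, a vector in ker X lies in the kernel of X - X_i, hence in that of its summand
R_iᵀ X R_i. -/
theorem mul_cayley_pow_mulVec_eq_zero (i : ℕ) {v : Fin n → ℝ} (hv : X *ᵥ v = 0) :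
    (X * cayley γ (A - G * X) ^ 2 ^ i) *ᵥ v = 0 := by
  have hD := posSemidef_sub_iter_X hG hH hγ hA hX0 hX i
  have hs := definite_iter hG hH hγ hA i
  have h := (hs.X.mulVec_eq_zero_of_add hD (by rw [add_sub_cancel]; exact hv)).2
  rw [sub_iter_X_eq hG hH hγ hA hX0 hX] at h
  exact hX0.mulVec_mul_eq_zero
    ((hX0.transpose_mul_mul _).mulVec_eq_zero_of_add (hs.Y.transpose_mul_mul _) h).1

end Iter

end SDA

/-! ### Frobenius norm estimates and quadratic convergence -/

section Norm

attribute [local instance] Matrix.frobeniusNormedAddCommGroup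

theorem Matrix.frobenius_norm_sq_eq_sum (C : Matrix (Fin n) (Fin m) ℝ) :
    ‖C‖ ^ 2 = ∑ i, ∑ j, C i j ^ 2 := by
  rw [frobenius_norm_def, ← Real.sqrt_eq_rpow, Real.sq_sqrt (by positivity)]
  simp

theorem Matrix.frobenius_norm_sq_eq_trace (C : Matrix (Fin n) (Fin m) ℝ) :
    ‖C‖ ^ 2 = (Cᵀ * C).trace := by
  rw [frobenius_norm_sq_eq_sum, Finset.sum_comm]
  simp [trace, mul_apply, sq]

theorem Matrix.trace_le_frobenius_norm (M : Matrix (Fin n) (Fin n) ℝ) : M.trace ≤ n * ‖M‖ := by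
  have h : ∀ i, M i i ≤ ‖M‖ := fun i => by
    refine le_of_sq_le_sq ?_ (norm_nonneg _)
    rw [frobenius_norm_sq_eq_sum]
    exact (Finset.single_le_sum (f := fun j => M i j ^ 2) (fun j _ => sq_nonneg _)
      (Finset.mem_univ i)).trans (Finset.single_le_sum (f := fun i => ∑ j, M i j ^ 2)
      (fun i _ => Finset.sum_nonneg fun j _ => sq_nonneg _) (Finset.mem_univ i))
  calc M.trace ≤ ∑ _i : Fin n, ‖M‖ := Finset.sum_le_sum fun i _ => h i
    _ = n * ‖M‖ := by simp

theorem Matrix.PosSemidef.frobenius_norm_le_trace {M : Matrix (Fin n) (Fin n) ℝ}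
    (h : M.PosSemidef) : ‖M‖ ≤ M.trace := by
  obtain ⟨C, rfl⟩ := h.exists_transpose_mul_self
  rw [← frobenius_norm_sq_eq_trace, sq]
  exact (frobenius_norm_mul _ _).trans_eq (by rw [frobenius_norm_transpose])

theorem Matrix.PosSemidef.trace_le_of_sub {M N : Matrix (Fin n) (Fin n) ℝ}
    (h : (N - M).PosSemidef) : M.trace ≤ N.trace := by
  have := h.trace_nonneg
  rw [trace_sub] at this
  linarith

namespace SDA

variable {A G H X Y : Matrix (Fin n) (Fin n) ℝ} {γ : ℝ} (hG : G.PosSemidef) (hH : H.PosSemidef)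
  (hγ : γ < 0) (hA : IsUnit (A + γ • (1 : Matrix (Fin n) (Fin n) ℝ)))
include hG hH hγ hA

/-- -Y_i is the X-iterate of the dual equation, so it lies below the dual solution; the trace is
monotone and dominates the norm. -/
theorem norm_iter_Y_le (hY0 : Y.PosSemidef) (hY : IsStabilizingSolution Aᵀ H G Y) (i : ℕ) :
    ‖-(iter A G H γ i).Y‖ ≤ Y.trace := by
  have h := posSemidef_sub_iter_X hH hG hγ (isUnit_transpose_add_smul hA) hY0 hY i
  rw [iter_dual hG hH hγ hA] at h
  exact (definite_iter hG hH hγ hA i).Y.frobenius_norm_le_trace.trans h.trace_le_of_sub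

theorem convergesQuadraticallyTo (hX0 : X.PosSemidef) (hX : IsStabilizingSolution A G H X)
    (hY0 : Y.PosSemidef) (hY : IsStabilizingSolution Aᵀ H G Y) :
    ConvergesQuadraticallyTo A G H γ X := by
  have hYi := norm_iter_Y_le hG hH hγ hA hY0 hY
  have hD := sub_iter_X_eq hG hH hγ hA hX0 hX
  have hDp := posSemidef_sub_iter_X hG hH hγ hA hX0 hX
  have hker : ∀ i v, X *ᵥ v = 0 → (X * cayley γ (A - G * X) ^ 2 ^ i) *ᵥ v = 0 := fun i v =>
    mul_cayley_pow_mulVec_eq_zero hG hH hγ hA hX0 hX i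
  have hlim := (hX.2.tendsto_norm_cayley_pow hγ).comp
    (tendsto_pow_atTop_atTop_of_one_lt (one_lt_two : 1 < 2))
  have hdef := definite_iter hG hH hγ hA
  have hRsucc : ∀ i, cayley γ (A - G * X) ^ 2 ^ (i + 1) =
      cayley γ (A - G * X) ^ 2 ^ i * cayley γ (A - G * X) ^ 2 ^ i := fun i => by
    rw [pow_succ 2, mul_two, pow_add]
  generalize hR : (fun i => cayley γ (A - G * X) ^ 2 ^ i) = R at *
  replace hR := fun i => congrFun hR i
  simp only [Function.comp_def, hR] at hD hker hlim hRsucc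
  set g := Y.trace
  have hg0 : 0 ≤ g := (norm_nonneg _).trans (hYi 0)
  obtain ⟨N, hN⟩ := exists_mul_mul_self X
  obtain ⟨C, hC⟩ := hX0.exists_transpose_mul_self
  have hmul3 : ∀ P Q S : Matrix (Fin n) (Fin n) ℝ, ‖P * Q * S‖ ≤ ‖P‖ * ‖Q‖ * ‖S‖ := fun P Q S =>
    (frobenius_norm_mul _ _).trans
      (mul_le_mul_of_nonneg_right (frobenius_norm_mul _ _) (norm_nonneg _))
  refine ⟨?_, ?_⟩
  · rw [tendsto_iff_norm_sub_tendsto_zero]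
    have hbound : ∀ i, ‖(iter A G H γ i).X - X‖ ≤
        ‖R i‖ * ‖X‖ * ‖R i‖ + (‖X‖ * ‖R i‖) * g * (‖X‖ * ‖R i‖) := by
      intro i
      rw [norm_sub_rev, hD]
      refine (norm_add_le _ _).trans (add_le_add ?_ ?_)
      · exact (hmul3 _ _ _).trans_eq (by rw [frobenius_norm_transpose])
      · refine (hmul3 _ _ _).trans ?_
        rw [frobenius_norm_transpose]
        have := frobenius_norm_mul X (R i)
        gcongr
        exact hYi i
    refine squeeze_zero (fun i => norm_nonneg _) hbound ?_
    have h := ((hlim.mul_const ‖X‖).mul hlim).add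
      (((hlim.const_mul ‖X‖).mul_const g).mul (hlim.const_mul ‖X‖))
    simpa using h
  -- The constant combines ‖X R_{i+1}‖ ≤ ‖N‖ ‖X R_i‖² and ‖X R_i‖² ≤ ‖C‖² n ‖D‖ with the factor ‖N‖
  -- + g from the error formula.
  · refine ⟨(‖N‖ + g) * (‖N‖ * (‖C‖ ^ 2 * n)) ^ 2, fun i => ?_⟩
    simp only [norm_sub_rev _ X]
    set D := X - (iter A G H γ i).X with hDi
    have h1 : ‖X * R i‖ ^ 2 ≤ ‖C‖ ^ 2 * (n * ‖D‖) := by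
      have ha : ‖X * R i‖ ≤ ‖C‖ * ‖C * R i‖ := by
        nth_rw 1 [hC]
        rw [Matrix.mul_assoc]
        exact (frobenius_norm_mul _ _).trans_eq (by rw [frobenius_norm_transpose])
      have hb : ‖C * R i‖ ^ 2 ≤ n * ‖D‖ := by
        refine le_trans ?_ (trace_le_frobenius_norm D)
        rw [frobenius_norm_sq_eq_trace, show (C * R i)ᵀ * (C * R i) = (R i)ᵀ * X * R i by
          rw [hC, transpose_mul]; simp only [Matrix.mul_assoc]]
        refine PosSemidef.trace_le_of_sub ?_
        rw [hDi, hD, add_sub_cancel_left]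
        exact (hdef i).Y.transpose_mul_mul _
      calc ‖X * R i‖ ^ 2 ≤ (‖C‖ * ‖C * R i‖) ^ 2 := by gcongr
        _ = ‖C‖ ^ 2 * ‖C * R i‖ ^ 2 := mul_pow _ _ _
        _ ≤ ‖C‖ ^ 2 * (n * ‖D‖) := by gcongr
    have h2 : X * R (i + 1) = X * R i * N * (X * R i) := by
      rw [hRsucc, ← Matrix.mul_assoc]
      nth_rw 1 [eq_mul_of_ker_le hN (hker i)]
      simp only [Matrix.mul_assoc]
    have h3 : ‖X * R (i + 1)‖ ≤ ‖N‖ * ‖X * R i‖ ^ 2 := by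
      rw [h2]
      exact (hmul3 _ _ _).trans_eq (by ring)
    -- Writing X = X N X makes the term R_{i+1}ᵀ X R_{i+1} quadratic in X R_{i+1} too.
    have h4 : X - (iter A G H γ (i + 1)).X =
        (X * R (i + 1))ᵀ * (N + -(iter A G H γ (i + 1)).Y) * (X * R (i + 1)) := by
      rw [hD, Matrix.mul_add, Matrix.add_mul]
      congr 1
      rw [transpose_mul, hX0.transpose_eq]
      nth_rw 1 [← hN]
      simp only [Matrix.mul_assoc]
    calc ‖X - (iter A G H γ (i + 1)).X‖
        ≤ ‖X * R (i + 1)‖ * (‖N‖ + g) * ‖X * R (i + 1)‖ := by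
          rw [h4]
          refine (hmul3 _ _ _).trans ?_
          rw [frobenius_norm_transpose]
          have := (norm_add_le N (-(iter A G H γ (i + 1)).Y)).trans
            (add_le_add_right (hYi (i + 1)) ‖N‖)
          gcongr
      _ = (‖N‖ + g) * ‖X * R (i + 1)‖ ^ 2 := by ring
      _ ≤ (‖N‖ + g) * (‖N‖ * (‖C‖ ^ 2 * (n * ‖D‖))) ^ 2 := by
          gcongr
          exact h3.trans (by gcongr)
      _ = (‖N‖ + g) * (‖N‖ * (‖C‖ ^ 2 * n)) ^ 2 * ‖D‖ ^ 2 := by ring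

end SDA

end Norm

/-! ### The outer iteration -/

namespace SCARE

variable {n m r : ℕ} {d : SCARE n m r}

/-- The residual is the frozen Riccati expression evaluated at X itself, so translation by X
applies. -/
theorem isStabilizingSolution_add_iff (hR : d.R.PosDef) {X Z : Matrix (Fin n) (Fin n) ℝ}
    (hX : X.PosSemidef) :
    IsStabilizingSolution (d.Ac X) (d.Gc X) (d.Hc X) (X + Z) ↔
      IsStabilizingSolution (d.Ac X - d.Gc X * X) (d.Gc X) (d.residual X) Z := by
  rw [residual_eq hR hX]
  exact _root_.isStabilizingSolution_add_iff (posSemidef_Gc hR hX) hX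

/-- If every frozen Riccati equation has a positive semidefinite stabilizing solution, the outer
iteration is well defined and unique. -/
theorem existsUnique_isFPSDASequence (hR : d.R.PosDef)
    (hex : ∀ X : Matrix (Fin n) (Fin n) ℝ, X.PosSemidef → ∃ Y : Matrix (Fin n) (Fin n) ℝ,
      Y.PosSemidef ∧ IsStabilizingSolution (d.Ac X) (d.Gc X) (d.Hc X) Y)
    {X₀ : Matrix (Fin n) (Fin n) ℝ} (hX₀ : X₀.PosSemidef) :
    (∃! X : ℕ → Matrix (Fin n) (Fin n) ℝ, d.IsFPSDASequence X₀ X) ∧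
    ∀ X : ℕ → Matrix (Fin n) (Fin n) ℝ, d.IsFPSDASequence X₀ X → ∀ k, (X k).PosSemidef ∧
      IsStabilizingSolution (d.Ac (X k)) (d.Gc (X k)) (d.Hc (X k)) (X (k + 1)) := by
  -- Every FPSDA sequence is the orbit of X₀ under f; the values of f off the semidefinite cone play
  -- no role.
  choose! f hf0 hf using hex
  have hnext : ∀ X Z : Matrix (Fin n) (Fin n) ℝ, X.PosSemidef →
      IsStabilizingSolution (d.Ac X - d.Gc X * X) (d.Gc X) (d.residual X) Z → X + Z = f X :=
    fun X Z hX hZ => (hf X hX).eq (posSemidef_Gc hR hX) (hf0 X hX)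
      ((isStabilizingSolution_add_iff hR hX).2 hZ)
  have hiter : ∀ k, (f^[k] X₀).PosSemidef := fun k => by
    induction k with
    | zero => exact hX₀
    | succ k ih => rw [Function.iterate_succ_apply']; exact hf0 _ ih
  have huniq : ∀ X : ℕ → Matrix (Fin n) (Fin n) ℝ, d.IsFPSDASequence X₀ X →
      ∀ k, X k = f^[k] X₀ := fun X hX k => by
    induction k with
    | zero => exact hX.1
    | succ k ih =>
      obtain ⟨Z, hZ, hk⟩ := hX.2 k
      rw [hk, hnext _ Z (by rw [ih]; exact hiter k) hZ, ih, Function.iterate_succ_apply']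
  refine ⟨⟨fun k => f^[k] X₀, ⟨rfl, fun k => ⟨f (f^[k] X₀) - f^[k] X₀, ?_, ?_⟩⟩,
    fun X hX => funext (huniq X hX)⟩, fun X hX k => ?_⟩
  · rw [← isStabilizingSolution_add_iff hR (hiter k), add_sub_cancel]
    exact hf _ (hiter k)
  · rw [add_sub_cancel]
    exact Function.iterate_succ_apply' f k X₀
  · rw [huniq X hX, huniq X hX, Function.iterate_succ_apply']
    exact ⟨hiter k, hf _ (hiter k)⟩

end SCARE

theorem mainTheorem3 {n m r p : ℕ} (d : SCARE n m r) (C : Matrix (Fin p) (Fin n) ℝ)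
    (hR : d.R.PosDef)
    (hQLR : (Matrix.fromBlocks d.Q d.L d.Lᵀ d.R).PosSemidef)
    (hstab : d.IsStabilizable)
    (hC : Cᵀ * C = d.schurQ)
    (hdet : d.IsDetectable C)
    (hker : ∀ v : Fin n → ℝ, d.schurQ *ᵥ v = 0 → d.Lᵀ *ᵥ v = 0 ∧ ∀ i, d.A₀ i *ᵥ v = 0)
    (hAB : IsStabilizablePair d.A d.B)
    (hQA : IsDetectablePair d.schurQ d.A)
    (X₀ : Matrix (Fin n) (Fin n) ℝ) (hX₀ : X₀.PosSemidef) :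
    (∃! X : ℕ → Matrix (Fin n) (Fin n) ℝ, d.IsFPSDASequence X₀ X) ∧
    ∀ X : ℕ → Matrix (Fin n) (Fin n) ℝ, d.IsFPSDASequence X₀ X →
      (∀ k, (X k).PosSemidef) ∧
      (∀ k, (∃! Y : Matrix (Fin n) (Fin n) ℝ,
          IsStabilizingSolution (d.Ac (X k)) (d.Gc (X k)) (d.Hc (X k)) Y) ∧
        IsStabilizingSolution (d.Ac (X k)) (d.Gc (X k)) (d.Hc (X k)) (X (k + 1))) ∧
      (∀ k, ∀ γ : ℝ, γ < 0 →
        IsUnit (d.Ac (X k) + γ • (1 : Matrix (Fin n) (Fin n) ℝ)) →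
          SDA.NoBreakdown (d.Ac (X k)) (d.Gc (X k)) (d.Hc (X k)) γ ∧
          SDA.ConvergesQuadraticallyTo (d.Ac (X k)) (d.Gc (X k)) (d.Hc (X k)) γ (X (k + 1))) := by
  have hG := fun X (hX : X.PosSemidef) => SCARE.posSemidef_Gc (d := d) (X := X) hR hX
  have hH := fun X (hX : X.PosSemidef) => SCARE.posSemidef_Hc (d := d) (X := X) hR hQLR hX
  have hF := fun X (hX : X.PosSemidef) =>
    SCARE.exists_isStableMatrix_Ac_add_Gc_mul (d := d) (X := X) hR hX hAB
  have hK := fun X (hX : X.PosSemidef) =>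
    SCARE.exists_isStableMatrix_Ac_add_mul_Hc (d := d) (X := X) hR hQLR hX hker hQA
  obtain ⟨hex, hall⟩ := SCARE.existsUnique_isFPSDASequence hR (fun X hX => by
    obtain ⟨F, hF⟩ := hF X hX
    obtain ⟨K, hK⟩ := hK X hX
    exact exists_posSemidef_isStabilizingSolution (hG X hX) (hH X hX) hF hK) hX₀
  refine ⟨hex, fun X hX => ⟨fun k => (hall X hX k).1, fun k => ?_, fun k γ hγ hA => ?_⟩⟩
  · have h := (hall X hX k).2
    exact ⟨⟨_, h, fun Y hY => h.eq (hG _ (hall X hX k).1) (hall X hX (k + 1)).1 hY⟩, h⟩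
  · obtain ⟨hXk, hs⟩ := hall X hX k
    obtain ⟨F, hF⟩ := hF _ hXk
    obtain ⟨K, hK⟩ := hK _ hXk
    obtain ⟨Y, hY0, hY⟩ := exists_posSemidef_dual (hG _ hXk) (hH _ hXk) hF hK
    exact ⟨SDA.noBreakdown (hG _ hXk) (hH _ hXk) hγ hA,
      SDA.convergesQuadraticallyTo (hG _ hXk) (hH _ hXk) hγ hA (hall X hX (k + 1)).1 hs hY0 hY⟩
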